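/- Let $d\ge 3$ and let $(G_n)_{n\in\mathbb N}$ be a sequence of finite connected $d$-regular simple graphs whose girths tend to infinity. Regard $G_n$ as a $1$-complex with edges of length $1$, and let $G_n\times G_n$ be the product square complex: its cells are the products of two cells of $G_n$, its $2$-cells are the Euclidean unit squares (edge $\times$ edge), and it carries the path metric. Then the family $(G_n\times G_n)_n$ is not $1$-hyperfinite. Here a family of finite complexes $K_n$ is called $k$-hyperfinite if for every $\epsilon>0$ there is an $R$ such that, for every $n$, one can remove from $K_n$ a set of at most an $\epsilon$-fraction of its $0$-cells, together with all the cells attached to them, so that the remaining complex $X_n$ is $k$-localizable with range $R$; that is, there is a continuous map from $X_n$ to a finite simplicial complex of dimension at most $k$ such that the preimage of every point has diameter less than $R$. So the claim is that there is an $\epsilon>0$ such that for every $R>0$ there is an $n$ for which, whichever set of at most an $\epsilon$-fraction of the $0$-cells of $G_n\times G_n$ is removed with the attached cells, every continuous map from what remains to a finite simplicial complex of dimension at most $1$ has a point preimage of diameter at least $R$. This holds both when diameters are measured in the path metric of the remaining complex $X_n$ (with distance $\infty$ between different components) and when they are measured in the path metric of $G_n\times G_n$. -/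

import Mathlib

open scoped ENNReal NNReal Topology

noncomputable section

/-- `F` is a nonempty face of the polytope spanned by `s`, given by its vertices: the points of `s`
at which some linear functional attains its maximum over `s`. -/
def IsPolytopeFace {E : Type*} [AddCommGroup E] [Module ℝ E] (F : Set E) (s : Finset E) : Prop :=
  F.Nonempty ∧ ∃ l : E →ₗ[ℝ] ℝ, F = {x | x ∈ s ∧ ∀ y ∈ s, l y ≤ l x}

/-- A finite polyhedral complex in a real normed space, all of whose edges have length `1`.
A closed cell is a convex polytope; it is recorded by its finite set of vertices `s`, so that the
closed cell itself is `convexHull ℝ s`. -/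
structure PolyhedralComplex (E : Type*) [NormedAddCommGroup E] [NormedSpace ℝ E] where
  /-- The cells, each one given by its vertices. -/
  cells : Set (Finset E)
  finite_cells : cells.Finite
  nonempty_of_mem : ∀ s ∈ cells, s.Nonempty
  /-- The points of `s` are exactly the vertices of the polytope that they span. -/
  extreme_of_mem : ∀ s ∈ cells, (s : Set E) ⊆ (convexHull ℝ (s : Set E)).extremePoints ℝ
  /-- A nonempty face of a cell is a cell. -/
  face_mem : ∀ s ∈ cells, ∀ t : Finset E, IsPolytopeFace (t : Set E) s → t ∈ cells
  /-- Two closed cells that meet do so in the closed cell spanned by their common vertices. -/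
  inter_subset : ∀ s ∈ cells, ∀ t ∈ cells,
    convexHull ℝ (s : Set E) ∩ convexHull ℝ (t : Set E) ⊆ convexHull ℝ ((s : Set E) ∩ t)
  /-- The common vertices of two cells, if there are any, span a face of either one. -/
  inter_isFace : ∀ s ∈ cells, ∀ t ∈ cells, ((s : Set E) ∩ t).Nonempty →
    IsPolytopeFace ((s : Set E) ∩ t) s
  dist_edge : ∀ s ∈ cells, s.card = 2 → ∀ x ∈ s, ∀ y ∈ s, x ≠ y → dist x y = 1

namespace PolyhedralComplex

variable {E : Type*} [NormedAddCommGroup E] [NormedSpace ℝ E]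

/-- The `0`-cells. -/
def vertices (K : PolyhedralComplex E) : Set E := {x | {x} ∈ K.cells}

/-- The underlying topological space: the union of the closed cells. -/
def space (K : PolyhedralComplex E) : Set E := {x | ∃ s ∈ K.cells, x ∈ convexHull ℝ (s : Set E)}

/-- The complex that remains when the `0`-cells in `S` are removed, together with all the cells
attached to them. -/
def deleteVertices (K : PolyhedralComplex E) (S : Finset E) : PolyhedralComplex E where
  cells := {s | s ∈ K.cells ∧ Disjoint s S}
  finite_cells := K.finite_cells.subset fun _ h => h.1
  nonempty_of_mem s hs := K.nonempty_of_mem s hs.1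
  extreme_of_mem s hs := K.extreme_of_mem s hs.1
  face_mem s hs t ht := by
    refine ⟨K.face_mem s hs.1 t ht, hs.2.mono_left fun x hx => ?_⟩
    obtain ⟨-, l, hl⟩ := ht
    have : x ∈ (t : Set E) := hx
    rw [hl] at this
    exact this.1
  inter_subset s hs t ht := K.inter_subset s hs.1 t ht.1
  inter_isFace s hs t ht := K.inter_isFace s hs.1 t ht.1
  dist_edge s hs := K.dist_edge s hs.1

/-- The path metric of the complex: the infimum of the lengths of the polygonal paths from `x` to
`y` each of whose pieces is a segment in one closed cell. It is `∞` for points in different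
components. -/
def pathEDist (K : PolyhedralComplex E) (x y : E) : ℝ≥0∞ :=
  ⨅ (n : ℕ) (p : ℕ → E) (_ : p 0 = x) (_ : p n = y)
    (_ : ∀ i < n, ∃ s ∈ K.cells,
      p i ∈ convexHull ℝ (s : Set E) ∧ p (i + 1) ∈ convexHull ℝ (s : Set E)),
    ∑ i ∈ Finset.range n, edist (p i) (p (i + 1))

end PolyhedralComplex

/-- The geometric realization of a finite simplicial complex: the formal convex combinations of the
vertices of a face, in barycentric coordinates. -/
def simplicialRealization {m : ℕ} (L : PreAbstractSimplicialComplex (Fin m)) : Set (Fin m → ℝ) :=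
  {x | x ∈ stdSimplex ℝ (Fin m) ∧ ∃ s ∈ L.faces, ∀ i, i ∉ s → x i = 0}

/-- A polyhedral complex `K`, with distances measured by `d`, is `k`-localizable with range `R` if
it has a continuous map to a (finite) simplicial complex of dimension at most `k` all of whose point
preimages have `d`-diameter less than `R`. -/
def IsLocalizable (k : ℕ) (R : ℝ≥0) {E : Type*} [NormedAddCommGroup E] [NormedSpace ℝ E]
    (K : PolyhedralComplex E) (d : E → E → ℝ≥0∞) : Prop :=
  ∃ (m : ℕ) (L : PreAbstractSimplicialComplex (Fin m)),
    (∀ s ∈ L.faces, s.card ≤ k + 1) ∧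
    ∃ f : K.space → simplicialRealization L, Continuous f ∧
      ∀ p, (⨆ (x : K.space) (y : K.space) (_ : f x = p) (_ : f y = p), d x y) < R

/-- A sequence of complexes is `k`-hyperfinite if for every `ε > 0` there is an `R` such that from
each of the complexes one can remove at most a fraction `ε` of the `0`-cells, with all the attached
cells, so that the remaining complex, with its own path metric, is `k`-localizable with
range `R`. -/
def IsHyperfinite (k : ℕ) {E : ℕ → Type*} [∀ n, NormedAddCommGroup (E n)]
    [∀ n, NormedSpace ℝ (E n)] (K : ∀ n, PolyhedralComplex (E n)) : Prop :=
  ∀ ε : ℝ, 0 < ε → ∃ R : ℝ≥0, ∀ n, ∃ S : Finset (E n), (S : Set (E n)) ⊆ (K n).vertices ∧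
    (S.card : ℝ) ≤ ε * (K n).vertices.ncard ∧
    IsLocalizable k R ((K n).deleteVertices S) ((K n).deleteVertices S).pathEDist

/-- The variant of `IsHyperfinite` in which distances between points of the remaining complex are
measured by the path metric of the original complex. -/
def IsAmbientHyperfinite (k : ℕ) {E : ℕ → Type*} [∀ n, NormedAddCommGroup (E n)]
    [∀ n, NormedSpace ℝ (E n)] (K : ∀ n, PolyhedralComplex (E n)) : Prop :=
  ∀ ε : ℝ, 0 < ε → ∃ R : ℝ≥0, ∀ n, ∃ S : Finset (E n), (S : Set (E n)) ⊆ (K n).vertices ∧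
    (S.card : ℝ) ≤ ε * (K n).vertices.ncard ∧
    IsLocalizable k R ((K n).deleteVertices S) (K n).pathEDist

section Graph

variable {V : Type*}

open scoped Classical in
/-- The point of the geometric realization of a graph that represents the vertex `v`. -/
def vertexPoint (v : V) : V → ℝ := Pi.single v 1

lemma vertexPoint_self (v : V) : vertexPoint v v = 1 := by simp [vertexPoint]

lemma vertexPoint_of_ne {v w : V} (h : w ≠ v) : vertexPoint v w = 0 := by simp [vertexPoint, h]

lemma vertexPoint_injective : Function.Injective (vertexPoint (V := V)) := by
  intro u v h
  by_contra hne
  have := congrFun h u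
  rw [vertexPoint_self, vertexPoint_of_ne hne] at this
  exact one_ne_zero this

variable [Fintype V]

lemma vertexPoint_mem_stdSimplex (v : V) : vertexPoint v ∈ stdSimplex ℝ V := by
  classical
  exact single_mem_stdSimplex ℝ v

lemma vertexPoint_extreme (v : V) : vertexPoint v ∈ (stdSimplex ℝ V).extremePoints ℝ := by
  refine ⟨vertexPoint_mem_stdSimplex v, ?_⟩
  rintro x ⟨hx0, hx1⟩ y ⟨hy0, hy1⟩ ⟨a, b, ha, hb, hab, h⟩
  have hx : ∀ w, w ≠ v → x w = 0 := by
    intro w hw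
    have := congrFun h w
    rw [vertexPoint_of_ne hw] at this
    simp only [Pi.add_apply, Pi.smul_apply, smul_eq_mul] at this
    nlinarith [mul_nonneg ha.le (hx0 w), mul_nonneg hb.le (hy0 w), hx0 w]
  funext w
  by_cases hw : w = v
  · subst hw
    rw [vertexPoint_self, ← hx1, Finset.sum_eq_single w (fun b _ hb => hx b hb) (by simp)]
  · rw [hx w hw, vertexPoint_of_ne hw]

lemma vertexPoint_affineIndependent :
    AffineIndependent ℝ ((↑) : (Finset.univ.map ⟨vertexPoint (V := V), vertexPoint_injective⟩ :
      Finset (V → ℝ)) → V → ℝ) := by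
  classical
  have h : LinearIndependent ℝ (vertexPoint (V := V)) := Pi.linearIndependent_single_one V ℝ
  refine h.affineIndependent.range.mono ?_
  simp

/-- The geometric realization of a finite graph: the vertices are the standard basis vectors of
`V → ℝ`, and the edges are segments, of length `1` in the supremum norm. Along each edge this norm
is the arc length; distances between points of different edges are measured by the path metric. -/
def graphComplex (G : SimpleGraph V) : PolyhedralComplex (V → ℝ) where
  cells := {s | ∃ u v, (u = v ∨ G.Adj u v) ∧ (s : Set (V → ℝ)) = {vertexPoint u, vertexPoint v}}
  finite_cells := by
    refine Set.Finite.subset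
      (Finset.finite_toSet (Finset.univ.map ⟨vertexPoint (V := V), vertexPoint_injective⟩).powerset) ?_
    rintro s ⟨u, v, -, hs⟩
    simp only [Finset.coe_powerset, Set.mem_preimage, Set.mem_powerset_iff, hs]
    rintro x (rfl | rfl) <;> simp
  nonempty_of_mem := by
    rintro s ⟨u, v, -, hs⟩
    exact ⟨vertexPoint u, by rw [← Finset.mem_coe, hs]; simp⟩
  extreme_of_mem := by
    rintro s ⟨u, v, -, hs⟩ x hx
    have hsub : convexHull ℝ (s : Set (V → ℝ)) ⊆ stdSimplex ℝ V := by
      refine convexHull_min ?_ (convex_stdSimplex ℝ V)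
      rw [hs]
      rintro x (rfl | rfl) <;> exact vertexPoint_mem_stdSimplex _
    refine inter_extremePoints_subset_extremePoints_of_subset hsub ⟨subset_convexHull ℝ _ hx, ?_⟩
    rw [hs] at hx
    rcases hx with rfl | rfl <;> exact vertexPoint_extreme _
  face_mem := by
    rintro s ⟨u, v, huv, hs⟩ t ⟨hne, l, hl⟩
    have hsub : (t : Set (V → ℝ)) ⊆ {vertexPoint u, vertexPoint v} := by
      rw [hl, ← hs]; exact fun x hx => hx.1
    rcases Set.subset_pair_iff_eq.1 hsub with h | h | h | h
    · exact absurd h hne.ne_empty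
    · exact ⟨u, u, Or.inl rfl, by simpa using h⟩
    · exact ⟨v, v, Or.inl rfl, by simpa using h⟩
    · exact ⟨u, v, huv, h⟩
  inter_subset := by
    rintro s ⟨u, v, -, hs⟩ t ⟨u', v', -, ht⟩
    refine (vertexPoint_affineIndependent.convexHull_inter ?_ ?_).superset
    · intro x hx
      rw [← Finset.mem_coe, hs] at hx
      rcases hx with rfl | rfl <;> simp
    · intro x hx
      rw [← Finset.mem_coe, ht] at hx
      rcases hx with rfl | rfl <;> simp
  inter_isFace := by
    classical
    rintro s ⟨u, v, -, hs⟩ t - hne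
    refine ⟨hne, ∑ w ∈ Finset.univ.filter (fun w => vertexPoint w ∈ t), LinearMap.proj w, ?_⟩
    have key : ∀ w : V, (∑ w ∈ Finset.univ.filter (fun w => vertexPoint w ∈ t),
        (LinearMap.proj w : (V → ℝ) →ₗ[ℝ] ℝ)) (vertexPoint w) =
          if vertexPoint w ∈ t then 1 else 0 := by
      intro w
      rw [LinearMap.sum_apply]
      simp only [LinearMap.proj_apply]
      have h0 : ∀ x : V, vertexPoint w x = if x = w then 1 else 0 := fun x => by
        simp [vertexPoint, Pi.single_apply]
      simp only [h0, Finset.sum_ite_eq', Finset.mem_filter, Finset.mem_univ, true_and]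
    have hsv : ∀ x ∈ s, ∃ w, x = vertexPoint w := by
      intro x hx
      rw [← Finset.mem_coe, hs] at hx
      rcases hx with rfl | rfl <;> exact ⟨_, rfl⟩
    ext x
    constructor
    · rintro ⟨hxs, hxt⟩
      refine ⟨hxs, fun y hy => ?_⟩
      obtain ⟨a, rfl⟩ := hsv x hxs
      obtain ⟨b, rfl⟩ := hsv y hy
      rw [key, key, if_pos (Finset.mem_coe.1 hxt)]
      split_ifs <;> norm_num
    · rintro ⟨hxs, hx⟩
      refine ⟨hxs, ?_⟩
      obtain ⟨y, hys, hyt⟩ := hne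
      obtain ⟨a, rfl⟩ := hsv x hxs
      obtain ⟨b, rfl⟩ := hsv y hys
      have := hx _ hys
      rw [key, key, if_pos (Finset.mem_coe.1 hyt)] at this
      by_contra hat
      rw [if_neg (fun h => hat (Finset.mem_coe.2 h))] at this
      norm_num at this
  dist_edge := by
    classical
    rintro s ⟨u, v, -, hs⟩ - x hx y hy hxy
    have key : ∀ a b : V, vertexPoint a ≠ vertexPoint b →
        dist (vertexPoint a) (vertexPoint b) = 1 := by
      intro a b hab
      have hab' : a ≠ b := fun h => hab (by rw [h])
      refine le_antisymm ((dist_pi_le_iff zero_le_one).2 fun i => ?_) ?_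
      · rw [Real.dist_eq]
        simp only [vertexPoint, Pi.single_apply]
        split_ifs <;> norm_num
      · have := dist_le_pi_dist (vertexPoint a) (vertexPoint b) a
        rwa [vertexPoint_self, vertexPoint_of_ne hab', dist_zero_right, norm_one] at this
    rw [← Finset.mem_coe, hs] at hx hy
    rcases hx with rfl | rfl <;> rcases hy with rfl | rfl <;> exact key _ _ hxy

end Graph

section Product

variable {E F : Type*} [NormedAddCommGroup E] [NormedSpace ℝ E]
  [NormedAddCommGroup F] [NormedSpace ℝ F]

/-- The vertices of the product of the polytopes with vertices `s` and `t`. -/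
def productCell (s : Finset E) (t : Finset F) : Finset (WithLp 2 (E × F)) :=
  (s ×ˢ t).map (WithLp.equiv 2 (E × F)).symm.toEmbedding

lemma mem_productCell {s : Finset E} {t : Finset F} {x : WithLp 2 (E × F)} :
    x ∈ productCell s t ↔ x.fst ∈ s ∧ x.snd ∈ t := by
  simp only [productCell, Finset.mem_map_equiv, Finset.mem_product]
  rfl

lemma convexHull_preimage_prod (A : Set E) (B : Set F) :
    convexHull ℝ {x : WithLp 2 (E × F) | x.fst ∈ A ∧ x.snd ∈ B} =
      {x | x.fst ∈ convexHull ℝ A ∧ x.snd ∈ convexHull ℝ B} := by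
  have h1 : ∀ (A : Set E) (B : Set F), {x : WithLp 2 (E × F) | x.fst ∈ A ∧ x.snd ∈ B} =
      (WithLp.linearEquiv 2 ℝ (E × F)).symm '' (A ×ˢ B) := by
    intro A B
    rw [LinearEquiv.image_symm_eq_preimage]
    rfl
  rw [h1, h1, ← convexHull_prod]
  exact ((WithLp.linearEquiv 2 ℝ (E × F)).symm.toLinearMap.image_convexHull _).symm

lemma coe_productCell (s : Finset E) (t : Finset F) :
    (productCell s t : Set (WithLp 2 (E × F))) =
      {x | x.fst ∈ (s : Set E) ∧ x.snd ∈ (t : Set F)} := by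
  ext x
  simp [mem_productCell]

lemma mem_convexHull_productCell {s : Finset E} {t : Finset F} {x : WithLp 2 (E × F)} :
    x ∈ convexHull ℝ (productCell s t : Set (WithLp 2 (E × F))) ↔
      x.fst ∈ convexHull ℝ (s : Set E) ∧ x.snd ∈ convexHull ℝ (t : Set F) := by
  rw [coe_productCell, convexHull_preimage_prod]
  rfl

/-- The maximizers of a functional over a product are the products of the maximizers of its
restrictions to the factors. -/
lemma maximizers_productCell (s : Finset E) (t : Finset F) (l₁ : E →ₗ[ℝ] ℝ) (l₂ : F →ₗ[ℝ] ℝ)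
    (x : WithLp 2 (E × F)) :
    (x ∈ productCell s t ∧ ∀ y ∈ productCell s t, l₁ y.fst + l₂ y.snd ≤ l₁ x.fst + l₂ x.snd) ↔
      (x.fst ∈ s ∧ ∀ y ∈ s, l₁ y ≤ l₁ x.fst) ∧ (x.snd ∈ t ∧ ∀ y ∈ t, l₂ y ≤ l₂ x.snd) := by
  simp only [mem_productCell]
  constructor
  · rintro ⟨⟨h1, h2⟩, h⟩
    refine ⟨⟨h1, fun y hy => ?_⟩, h2, fun y hy => ?_⟩
    · simpa using h (WithLp.toLp 2 (y, x.snd)) ⟨hy, h2⟩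
    · simpa using h (WithLp.toLp 2 (x.fst, y)) ⟨h1, hy⟩
  · rintro ⟨⟨h1, h1'⟩, h2, h2'⟩
    exact ⟨⟨h1, h2⟩, fun y hy => add_le_add (h1' _ hy.1) (h2' _ hy.2)⟩

/-- The product of two polyhedral complexes: its cells are the products of a cell of `K` and a cell
of `L`, with the Euclidean product metric. In particular the product of two edges is a Euclidean
unit square. -/
def PolyhedralComplex.prod (K : PolyhedralComplex E) (L : PolyhedralComplex F) :
    PolyhedralComplex (WithLp 2 (E × F)) where
  cells := {c | ∃ s ∈ K.cells, ∃ t ∈ L.cells, c = productCell s t}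
  finite_cells := by
    refine ((K.finite_cells.prod L.finite_cells).image fun p => productCell p.1 p.2).subset ?_
    rintro c ⟨s, hs, t, ht, rfl⟩
    exact ⟨(s, t), ⟨hs, ht⟩, rfl⟩
  nonempty_of_mem := by
    rintro c ⟨s, hs, t, ht, rfl⟩
    exact ((K.nonempty_of_mem s hs).product (L.nonempty_of_mem t ht)).map
  extreme_of_mem := by
    rintro c ⟨s, hs, t, ht, rfl⟩ x hx
    rw [Finset.mem_coe, mem_productCell] at hx
    have h1 := K.extreme_of_mem s hs hx.1
    have h2 := L.extreme_of_mem t ht hx.2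
    refine ⟨mem_convexHull_productCell.2 ⟨h1.1, h2.1⟩, ?_⟩
    rintro y hy z hz ⟨a, b, ha, hb, hab, h⟩
    rw [mem_convexHull_productCell] at hy hz
    have e1 := h1.2 hy.1 hz.1 ⟨a, b, ha, hb, hab, by rw [← h]; rfl⟩
    have e2 := h2.2 hy.2 hz.2 ⟨a, b, ha, hb, hab, by rw [← h]; rfl⟩
    exact (WithLp.ofLp_injective 2) (Prod.ext e1 e2)
  face_mem := by
    classical
    rintro c ⟨s, hs, t, ht, rfl⟩ c' ⟨hne, l, hl⟩
    set l₁ : E →ₗ[ℝ] ℝ :=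
      l ∘ₗ (WithLp.linearEquiv 2 ℝ (E × F)).symm.toLinearMap ∘ₗ LinearMap.inl ℝ E F with hl₁
    set l₂ : F →ₗ[ℝ] ℝ :=
      l ∘ₗ (WithLp.linearEquiv 2 ℝ (E × F)).symm.toLinearMap ∘ₗ LinearMap.inr ℝ E F with hl₂
    have hsplit : ∀ x : WithLp 2 (E × F), l x = l₁ x.fst + l₂ x.snd := by
      intro x
      rw [hl₁, hl₂]
      simp only [LinearMap.comp_apply, ← map_add]
      congr 1
      exact (WithLp.ofLp_injective 2) (Prod.ext (by simp) (by simp))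
    have hmem : ∀ x, x ∈ c' ↔ (x.fst ∈ s ∧ ∀ y ∈ s, l₁ y ≤ l₁ x.fst) ∧
        (x.snd ∈ t ∧ ∀ y ∈ t, l₂ y ≤ l₂ x.snd) := by
      intro x
      rw [← maximizers_productCell s t l₁ l₂,
        ← Finset.mem_coe, hl]
      simp only [Set.mem_ofPred_eq, hsplit]
    obtain ⟨x, hx⟩ := hne
    have hx' := (hmem x).1 hx
    refine ⟨s.filter fun a => ∀ y ∈ s, l₁ y ≤ l₁ a, K.face_mem s hs _ ⟨⟨x.fst, by simpa using hx'.1⟩,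
      l₁, by ext; simp⟩, t.filter fun a => ∀ y ∈ t, l₂ y ≤ l₂ a,
      L.face_mem t ht _ ⟨⟨x.snd, by simpa using hx'.2⟩, l₂, by ext; simp⟩, ?_⟩
    ext y
    rw [hmem, mem_productCell, Finset.mem_filter, Finset.mem_filter]
  inter_subset := by
    rintro c ⟨s, hs, t, ht, rfl⟩ c' ⟨s', hs', t', ht', rfl⟩ x ⟨hx, hx'⟩
    rw [mem_convexHull_productCell] at hx hx'
    have h : (productCell s t : Set (WithLp 2 (E × F))) ∩ productCell s' t' =
        {x | x.fst ∈ (s : Set E) ∩ s' ∧ x.snd ∈ (t : Set F) ∩ t'} := by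
      ext y
      simp only [Set.mem_inter_iff, Finset.mem_coe, mem_productCell, Set.mem_ofPred_eq]
      tauto
    rw [h, convexHull_preimage_prod]
    exact ⟨K.inter_subset s hs s' hs' ⟨hx.1, hx'.1⟩, L.inter_subset t ht t' ht' ⟨hx.2, hx'.2⟩⟩
  inter_isFace := by
    rintro c ⟨s, hs, t, ht, rfl⟩ c' ⟨s', hs', t', ht', rfl⟩ hne
    obtain ⟨x, hx, hx'⟩ := hne
    rw [Finset.mem_coe, mem_productCell] at hx hx'
    obtain ⟨-, l₁, h1⟩ := K.inter_isFace s hs s' hs' ⟨x.fst, hx.1, hx'.1⟩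
    obtain ⟨-, l₂, h2⟩ := L.inter_isFace t ht t' ht' ⟨x.snd, hx.2, hx'.2⟩
    refine ⟨⟨x, mem_productCell.2 hx, mem_productCell.2 hx'⟩,
      (l₁ ∘ₗ LinearMap.fst ℝ E F + l₂ ∘ₗ LinearMap.snd ℝ E F) ∘ₗ
        (WithLp.linearEquiv 2 ℝ (E × F)).toLinearMap, ?_⟩
    ext y
    have key := maximizers_productCell s t l₁ l₂ y
    have e1 : (y.fst ∈ s ∧ y.fst ∈ s') ↔ (y.fst ∈ s ∧ ∀ z ∈ s, l₁ z ≤ l₁ y.fst) :=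
      Set.ext_iff.1 h1 y.fst
    have e2 : (y.snd ∈ t ∧ y.snd ∈ t') ↔ (y.snd ∈ t ∧ ∀ z ∈ t, l₂ z ≤ l₂ y.snd) :=
      Set.ext_iff.1 h2 y.snd
    rw [← e1, ← e2] at key
    refine Iff.trans ?_ key.symm
    simp only [Set.mem_inter_iff, Finset.mem_coe, mem_productCell]
    tauto
  dist_edge := by
    rintro c ⟨s, hs, t, ht, rfl⟩ hc x hx y hy hxy
    rw [mem_productCell] at hx hy
    rw [productCell, Finset.card_map, Finset.card_product] at hc
    rw [WithLp.prod_dist_eq_of_L2]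
    rcases (Nat.prime_mul_iff.1 (hc ▸ Nat.prime_two)) with ⟨-, h1⟩ | ⟨-, h1⟩
    · rw [h1, mul_one] at hc
      have e2 : x.snd = y.snd := Finset.card_le_one.1 h1.le _ hx.2 _ hy.2
      have e1 : x.fst ≠ y.fst := fun h => hxy ((WithLp.ofLp_injective 2) (Prod.ext h e2))
      rw [K.dist_edge s hs hc _ hx.1 _ hy.1 e1, e2, dist_self]
      norm_num
    · rw [h1, one_mul] at hc
      have e1 : x.fst = y.fst := Finset.card_le_one.1 h1.le _ hx.1 _ hy.1
      have e2 : x.snd ≠ y.snd := fun h => hxy ((WithLp.ofLp_injective 2) (Prod.ext e1 h))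
      rw [L.dist_edge t ht hc _ hx.2 _ hy.2 e2, e1, dist_self]
      norm_num

end Product

end

/-! The product `G × G` carries many 2-cycles: tensors of 1-cycles of `G` form a space of dimension
at least `(|E| - |V|)²`, and `|E| - |V| ≥ |V| / 2` because `d ≥ 3`. Removing one vertex destroys at
most `d²` squares, so after removing a fraction `1 / (8 d²)` of the vertices some nonzero 2-cycle
`c` survives (`exists_cycle_avoiding`). Fix a square `(e, e')` with `c e e' ≠ 0`.

Suppose that the remaining complex maps to a 1-dimensional complex with small fibres. Rounding the
barycentric coordinates of the image and choosing one point for each rounded value gives a self-map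
`g`, possibly discontinuous, which moves points a bounded amount and takes at most two values on
each sufficiently small set (`exists_two_valued_map`). It plays the role of a factorization through
a graph.

Counting signed crossings of `e` in the first factor and of `e'` in the second gives a pair of
1-cochains. On balls small compared with the girth they have potentials
(`SimpleGraph.geodesicCrossing_eq_sub`), hence they develop such regions into the plane, and signed
areas make sense there. Subdivide the squares finely. For a small square `x y z w`, the four
quadrilaterals joining its sides to their images under `g` have total area equal to the area of `x y
z w` minus that of the image, and the image has no area since it has at most two distinct vertices
(`quadArea_eq_sum`). The side quadrilaterals change sign with the direction of the side, so they
cancel over the cycle (`sum_cycle_boundary_eq_zero`). Thus the cycle has total area zero. But only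
the square `(e, e')` has nonzero area, and the total is a nonzero multiple of `c e e'`, a
contradiction. -/

noncomputable section

/-! ### Crossing numbers of walks in graphs of large girth -/

namespace SimpleGraph

variable {V : Type*}

open scoped Classical in
/-- The sign with which the step from `u` to `v` crosses the oriented edge from `s` to `t`. -/
def stepSign (s t u v : V) : ℝ :=
  (if u = s ∧ v = t then 1 else 0) - (if u = t ∧ v = s then 1 else 0)

lemma stepSign_swap (s t u v : V) : stepSign s t v u = -stepSign s t u v := by
  rw [stepSign, stepSign, neg_sub]
  congr 1 <;> (congr 1; exact propext and_comm)

lemma stepSign_refl (s t u : V) : stepSign s t u u = 0 := by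
  linarith [stepSign_swap s t u u]

lemma stepSign_self {s t : V} (h : s ≠ t) : stepSign s t s t = 1 := by
  simp [stepSign, h]

lemma stepSign_of_ne {s t u v : V} (h : s(u, v) ≠ s(s, t)) : stepSign s t u v = 0 := by
  rw [ne_eq, Sym2.eq_iff] at h
  push Not at h
  have h1 : ¬(u = s ∧ v = t) := fun h' => h.1 h'.1 h'.2
  have h2 : ¬(u = t ∧ v = s) := fun h' => h.2 h'.1 h'.2
  simp [stepSign, h1, h2]

variable {G : SimpleGraph V}

/-- The signed number of times that a walk crosses the oriented edge from `s` to `t`. -/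
def Walk.crossing (s t : V) {u v : V} : G.Walk u v → ℝ
  | .nil => 0
  | .cons (u := u) (v := w) _ p => stepSign s t u w + p.crossing s t

lemma Walk.crossing_append (s t : V) {u v w : V} (p : G.Walk u v) (q : G.Walk v w) :
    (p.append q).crossing s t = p.crossing s t + q.crossing s t := by
  induction p with
  | nil => simp [Walk.crossing]
  | cons h p ih => simp [Walk.crossing, ih, add_assoc]

lemma Walk.crossing_reverse (s t : V) {u v : V} (p : G.Walk u v) :
    p.reverse.crossing s t = -p.crossing s t := by
  induction p with
  | nil => simp [Walk.crossing]
  | @cons a b c h p ih =>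
    rw [Walk.reverse_cons, Walk.crossing_append, ih]
    simp only [Walk.crossing, add_zero]
    rw [stepSign_swap s t a b]
    ring

/-- The sum telescopes. A potential is demanded only along the edges of the walk, where one exists
even if the whole graph has none. -/
lemma Walk.crossing_eq_sub (s t : V) (F : V → ℝ) {u v : V} (p : G.Walk u v)
    (hF : ∀ a b, s(a, b) ∈ p.edges → stepSign s t a b = F b - F a) :
    p.crossing s t = F v - F u := by
  induction p with
  | nil => simp [Walk.crossing]
  | cons h p ih =>
    rw [Walk.crossing, ih fun a b hab => hF a b (by simp [hab]), hF _ _ (by simp)]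
    ring

/-- A closed walk that is shorter than the girth crosses every edge a total of zero times. -/
lemma Walk.crossing_eq_zero (s t : V) {u : V} (p : G.Walk u u)
    (hp : (p.length : ℕ∞) < G.egirth) : p.crossing s t = 0 := by
  classical
  by_cases hst : s(s, t) ∈ p.edges
  swap
  · rw [p.crossing_eq_sub s t (fun _ => 0), sub_zero]
    intro a b hab
    rw [stepSign_of_ne fun h => hst (h ▸ hab), sub_zero]
  -- The walk traverses fewer distinct edges than the girth, so they form a forest `H`, in which
  -- `s(s, t)` is a bridge.
  set H : SimpleGraph V := fromEdgeSet {e | e ∈ p.edges} with hH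
  have hGst : G.Adj s t := p.adj_of_mem_edges hst
  have hHadj : ∀ a b, H.Adj a b ↔ s(a, b) ∈ p.edges := fun a b => by
    rw [hH, fromEdgeSet_adj]
    exact ⟨fun h => h.1, fun h => ⟨h, (p.adj_of_mem_edges h).ne⟩⟩
  have hHG : H ≤ G := fun a b hab => p.adj_of_mem_edges ((hHadj a b).1 hab)
  have hbridge : H.IsBridge s(s, t) := by
    rw [isBridge_iff_forall_cycle_notMem ((hHadj s t).2 hst)]
    intro w q hq _
    have h1 := egirth_le_length (hq.mapLe hHG)
    have h2 : q.edges.toFinset ⊆ p.edges.toFinset := by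
      intro e he
      rw [List.mem_toFinset] at he ⊢
      have := q.edges_subset_edgeSet he
      induction e with
      | _ a b => exact (hHadj a b).1 this
    have h3 := Finset.card_le_card h2
    rw [List.toFinset_card_of_nodup hq.edges_nodup, Walk.length_edges] at h3
    have h4 := p.edges.toFinset_card_le
    rw [Walk.length_edges] at h4
    rw [Walk.length_map] at h1
    exact absurd (hp.trans_le h1) (not_lt.2 (by exact_mod_cast h3.trans h4))
  rw [isBridge_iff] at hbridge
  set H' := H \ fromEdgeSet {s(s, t)} with hH'
  have hFs : ¬ H'.Reachable s t := hbridge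
  -- The potential is the indicator of the side of the bridge that contains `t`.
  rw [p.crossing_eq_sub s t (fun x => if H'.Reachable x t then 1 else 0), sub_self]
  intro a b hab
  by_cases h : s(a, b) = s(s, t)
  · rcases Sym2.eq_iff.1 h with ⟨rfl, rfl⟩ | ⟨rfl, rfl⟩
    · rw [stepSign_self hGst.ne, if_pos (Reachable.refl _), if_neg hFs, sub_zero]
    · rw [stepSign_swap, stepSign_self hGst.ne, if_pos (Reachable.refl _), if_neg hFs, zero_sub]
  · have hadj : H'.Adj a b := by
      rw [hH', sdiff_adj, fromEdgeSet_adj]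
      exact ⟨(hHadj a b).2 hab, fun h' => h h'.1⟩
    have : H'.Reachable a t ↔ H'.Reachable b t :=
      ⟨fun h => hadj.symm.reachable.trans h, fun h => hadj.reachable.trans h⟩
    rw [stepSign_of_ne h]
    simp only [this, sub_self]

/-- The signed number of times that a geodesic from `u` to `v` crosses the oriented edge from `s`
to `t`. -/
def geodesicCrossing (hG : G.Connected) (s t u v : V) : ℝ :=
  (hG.exists_walk_length_eq_dist u v).choose.crossing s t

/-- The geodesic followed by the reversed walk is a closed walk shorter than the girth, so the
arbitrary choice of geodesic is immaterial. -/
lemma geodesicCrossing_eq (hG : G.Connected) (s t : V) {u v : V} (p : G.Walk u v)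
    (hp : ((G.dist u v + p.length : ℕ) : ℕ∞) < G.egirth) :
    geodesicCrossing hG s t u v = p.crossing s t := by
  have h := (hG.exists_walk_length_eq_dist u v).choose_spec
  have := ((hG.exists_walk_length_eq_dist u v).choose.append p.reverse).crossing_eq_zero s t
    (by rwa [Walk.length_append, Walk.length_reverse, h])
  rw [Walk.crossing_append, Walk.crossing_reverse] at this
  exact add_neg_eq_zero.1 this

lemma geodesicCrossing_of_adj (hG : G.Connected) (s t : V) {u v : V} (h : u = v ∨ G.Adj u v)
    (hg : 2 < G.egirth) : geodesicCrossing hG s t u v = stepSign s t u v := by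
  rcases h with rfl | h
  · rw [geodesicCrossing_eq hG s t Walk.nil (by simp; exact lt_of_le_of_lt (by simp) hg)]
    simp [Walk.crossing, stepSign_refl]
  · rw [geodesicCrossing_eq hG s t h.toWalk (by
      rw [dist_eq_one_iff_adj.2 h]; simpa [Adj.toWalk, one_add_one_eq_two] using hg)]
    simp [Walk.crossing]

/-- On a ball whose radius is small compared with the girth, the crossing numbers of geodesics are
the differences of a potential. -/
lemma geodesicCrossing_eq_sub (hG : G.Connected) (s t : V) {o u v : V} {r : ℕ}
    (hg : ((4 * r : ℕ) : ℕ∞) < G.egirth) (hu : G.dist o u ≤ r) (hv : G.dist o v ≤ r) :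
    geodesicCrossing hG s t u v = geodesicCrossing hG s t o v - geodesicCrossing hG s t o u := by
  obtain ⟨p, hp⟩ := hG.exists_walk_length_eq_dist o u
  obtain ⟨q, hq⟩ := hG.exists_walk_length_eq_dist o v
  have huv : G.dist u v ≤ r + r := by
    have := hG.dist_triangle (u := u) (v := o) (w := v)
    rw [dist_comm (u := u) (v := o)] at this
    omega
  -- The detour through `o` and the geodesic from `u` to `v` each have length at most `2 * r`; hence
  -- the bound `4 * r`.
  have key : ∀ n : ℕ, n ≤ 4 * r → (n : ℕ∞) < G.egirth := fun n hn =>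
    lt_of_le_of_lt (by exact_mod_cast hn) hg
  rw [geodesicCrossing_eq hG s t (p.reverse.append q) (key _ (by simp; omega)),
    geodesicCrossing_eq hG s t p (key _ (by omega)),
    geodesicCrossing_eq hG s t q (key _ (by omega)), Walk.crossing_append, Walk.crossing_reverse]
  ring

end SimpleGraph

/-! ### Cycles of a graph and of its square -/

/-- Rank-nullity for the boundary map `B`. Being a cycle is expressed by orthogonality to all
coboundaries, the form in which it is used later. -/
lemma exists_linearIndependent_cycles {E V : Type*} [Fintype E] [Fintype V] (src tgt : E → V)
    {k : ℕ} (hk : k + Fintype.card V ≤ Fintype.card E) :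
    ∃ z : Fin k → E → ℝ, LinearIndependent ℝ z ∧
      ∀ i, ∀ g : V → ℝ, ∑ e, z i e * (g (tgt e) - g (src e)) = 0 := by
  classical
  let B : (E → ℝ) →ₗ[ℝ] (V → ℝ) :=
    ∑ e, (LinearMap.proj e).smulRight (Pi.single (tgt e) 1 - Pi.single (src e) 1)
  have hB : ∀ z v, B z v = ∑ e, z e * ((Pi.single (tgt e) 1 - Pi.single (src e) 1 : V → ℝ) v) := by
    intro z v
    simp [B, LinearMap.sum_apply, Finset.sum_apply]
  have hdim : k ≤ Module.finrank ℝ (LinearMap.ker B) := by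
    have h1 := B.finrank_range_add_finrank_ker
    have h2 : Module.finrank ℝ (LinearMap.range B) ≤ Fintype.card V := by
      simpa using Submodule.finrank_le (LinearMap.range B)
    rw [Module.finrank_fintype_fun_eq_card] at h1
    omega
  let b := Module.finBasis ℝ (LinearMap.ker B)
  refine ⟨fun i => (b (Fin.castLE hdim i) : E → ℝ), ?_, ?_⟩
  · exact (b.linearIndependent.comp _ (Fin.castLE_injective hdim)).map' (LinearMap.ker B).subtype
      (Submodule.ker_subtype _)
  · intro i g
    have h0 : B (b (Fin.castLE hdim i) : E → ℝ) = 0 := (b (Fin.castLE hdim i)).2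
    set z : E → ℝ := (b (Fin.castLE hdim i) : E → ℝ)
    have : ∑ v, g v * B z v = 0 := by simp [h0]
    rw [← this]
    simp only [hB, Finset.mul_sum]
    rw [Finset.sum_comm]
    refine Finset.sum_congr rfl fun e _ => ?_
    have : ∀ w, ∑ v, g v * (Pi.single w 1 : V → ℝ) v = g w := fun w => by
      simp [Pi.single_apply]
    simp only [Pi.sub_apply]
    calc z e * (g (tgt e) - g (src e))
        = z e * (∑ v, g v * (Pi.single (tgt e) 1 : V → ℝ) v -
            ∑ v, g v * (Pi.single (src e) 1 : V → ℝ) v) := by rw [this, this]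
      _ = _ := by
        rw [← Finset.sum_sub_distrib, Finset.mul_sum]
        exact Finset.sum_congr rfl fun v _ => by ring

/-- If fewer squares are excluded than the square of the first Betti number of the graph, then some
nonzero `2`-cycle of the product of the graph with itself avoids them. -/
lemma exists_product_cycle {E V : Type*} [Fintype E] [Fintype V] (src tgt : E → V)
    {k : ℕ} (hk : k + Fintype.card V ≤ Fintype.card E) (bad : Finset (E × E))
    (hbad : bad.card < k ^ 2) :
    ∃ c : E → E → ℝ, (∃ a b, c a b ≠ 0) ∧ (∀ a b, (a, b) ∈ bad → c a b = 0) ∧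
      (∀ b, ∀ g : V → ℝ, ∑ a, c a b * (g (tgt a) - g (src a)) = 0) ∧
      ∀ a, ∀ g : V → ℝ, ∑ b, c a b * (g (tgt b) - g (src b)) = 0 := by
  classical
  obtain ⟨z, hz, hcyc⟩ := exists_linearIndependent_cycles src tgt hk
  -- `T` sends a coefficient matrix `M` to the values of `∑ M i j • z i ⊗ z j` on the excluded
  -- squares; there are more coefficients than conditions.
  let T : (Fin k × Fin k → ℝ) →ₗ[ℝ] (bad → ℝ) :=
    LinearMap.pi fun q => ∑ p : Fin k × Fin k, (z p.1 q.1.1 * z p.2 q.1.2) • LinearMap.proj p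
  have hT : ¬ Function.Injective T := fun h => by
    have := LinearMap.finrank_le_finrank_of_injective h
    simp only [Module.finrank_fintype_fun_eq_card, Fintype.card_prod, Fintype.card_fin,
      Fintype.card_coe] at this
    rw [sq] at hbad
    omega
  obtain ⟨M, hM, hM0⟩ : ∃ M, T M = 0 ∧ M ≠ 0 := by
    rw [← LinearMap.ker_eq_bot, Submodule.eq_bot_iff] at hT
    push Not at hT
    exact hT
  refine ⟨fun a b => ∑ i, ∑ j, M (i, j) * (z i a * z j b), ?_, ?_, ?_, ?_⟩
  · by_contra! hc
    refine hM0 (funext fun p => ?_)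
    -- Independence of the `z i` is used twice, first in the variable `a` with `b` fixed and then in
    -- `b`.
    have h1 : ∀ b i, ∑ j, M (i, j) * z j b = 0 := by
      intro b
      refine Fintype.linearIndependent_iff.1 hz _ (funext fun a => ?_)
      rw [Finset.sum_apply, Pi.zero_apply, ← hc a b]
      refine Finset.sum_congr rfl fun i _ => ?_
      rw [Pi.smul_apply, smul_eq_mul, Finset.sum_mul]
      exact Finset.sum_congr rfl fun j _ => by ring
    refine Fintype.linearIndependent_iff.1 hz (fun j => M (p.1, j)) (funext fun b => ?_) p.2
    rw [Finset.sum_apply, Pi.zero_apply, ← h1 b p.1]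
    rfl
  · intro a b hab
    have := congrFun hM ⟨(a, b), hab⟩
    simp only [T, LinearMap.pi_apply, LinearMap.sum_apply, LinearMap.smul_apply,
      LinearMap.proj_apply, smul_eq_mul, Pi.zero_apply, Fintype.sum_prod_type] at this
    rw [← this]
    exact Finset.sum_congr rfl fun i _ => Finset.sum_congr rfl fun j _ => mul_comm _ _
  · intro b g
    simp only [Finset.sum_mul]
    rw [Finset.sum_comm]
    refine Finset.sum_eq_zero fun i _ => ?_
    rw [Finset.sum_comm]
    refine Finset.sum_eq_zero fun j _ => ?_
    have := congrArg (fun x => M (i, j) * z j b * x) (hcyc i g)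
    simp only [mul_zero, Finset.mul_sum] at this
    rw [← this]
    exact Finset.sum_congr rfl fun a _ => by ring
  · intro a g
    simp only [Finset.sum_mul]
    rw [Finset.sum_comm]
    refine Finset.sum_eq_zero fun i _ => ?_
    rw [Finset.sum_comm]
    refine Finset.sum_eq_zero fun j _ => ?_
    have := congrArg (fun x => M (i, j) * z i a * x) (hcyc j g)
    simp only [mul_zero, Finset.mul_sum] at this
    rw [← this]
    exact Finset.sum_congr rfl fun b _ => by ring

/-! ### Compactness and lower bounds for the path metric -/

lemma PolyhedralComplex.isCompact_space {E : Type*} [NormedAddCommGroup E] [NormedSpace ℝ E]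
    (K : PolyhedralComplex E) : IsCompact K.space := by
  have : K.space = ⋃ s ∈ K.cells, convexHull ℝ (s : Set E) := by
    ext x
    simp [PolyhedralComplex.space]
  rw [this]
  exact K.finite_cells.isCompact_biUnion fun s _ => s.finite_toSet.isCompact_convexHull (𝕜 := ℝ)

lemma PolyhedralComplex.pathEDist_le_deleteVertices {E : Type*} [NormedAddCommGroup E]
    [NormedSpace ℝ E] (K : PolyhedralComplex E) (S : Finset E) (x y : E) :
    K.pathEDist x y ≤ (K.deleteVertices S).pathEDist x y := by
  refine le_iInf fun n => le_iInf fun p => le_iInf fun h0 => le_iInf fun hn => le_iInf fun hp => ?_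
  refine iInf_le_of_le n (iInf_le_of_le p (iInf_le_of_le h0 (iInf_le_of_le hn
    (iInf_le_of_le (fun i hi => ?_) le_rfl))))
  obtain ⟨s, hs, h⟩ := hp i hi
  exact ⟨s, hs.1, h⟩

/-- A function that is `1`-Lipschitz on each cell is `1`-Lipschitz for the path metric. -/
lemma PolyhedralComplex.abs_sub_le_of_pathEDist_le {E : Type*} [NormedAddCommGroup E]
    [NormedSpace ℝ E] (K : PolyhedralComplex E) (D : E → ℝ)
    (hD : ∀ s ∈ K.cells, ∀ x ∈ convexHull ℝ (s : Set E), ∀ y ∈ convexHull ℝ (s : Set E),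
      |D x - D y| ≤ dist x y) {x y : E} {R : ℝ≥0} (h : K.pathEDist x y ≤ R) :
    |D x - D y| ≤ R := by
  have : edist (D x) (D y) ≤ K.pathEDist x y := by
    refine le_iInf fun n => le_iInf fun p => le_iInf fun h0 => le_iInf fun hn =>
      le_iInf fun hp => ?_
    rw [← h0, ← hn]
    refine (edist_le_range_sum_edist (fun i => D (p i)) n).trans (Finset.sum_le_sum fun i hi => ?_)
    obtain ⟨s, hs, h1, h2⟩ := hp i (Finset.mem_range.1 hi)
    rw [edist_dist, edist_dist, Real.dist_eq]
    exact ENNReal.ofReal_le_ofReal (hD s hs _ h1 _ h2)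
  have h2 := this.trans h
  rw [edist_le_coe] at h2
  have : dist (D x) (D y) ≤ R := by exact_mod_cast h2
  rwa [Real.dist_eq] at this

/-! ### Points on edges and a continuous substitute for the distance -/

section Graph

variable {V : Type*}

/-- The point at time `t` on the edge from `u` to `v`. -/
def edgePoint (u v : V) (t : ℝ) : V → ℝ := (1 - t) • vertexPoint u + t • vertexPoint v

lemma mem_convexHull_cell {u v : V} {s : Finset (V → ℝ)}
    (hs : (s : Set (V → ℝ)) = {vertexPoint u, vertexPoint v}) {x : V → ℝ} :
    x ∈ convexHull ℝ (s : Set (V → ℝ)) ↔ ∃ t ∈ Set.Icc (0 : ℝ) 1, edgePoint u v t = x := by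
  rw [hs, convexHull_pair, segment_eq_image]
  rfl

lemma edgePoint_apply_eq_zero {u v w : V} (t : ℝ) (hu : w ≠ u) (hv : w ≠ v) :
    edgePoint u v t w = 0 := by
  simp [edgePoint, vertexPoint_of_ne hu, vertexPoint_of_ne hv]

lemma dist_edgePoint_le (u v : V) [Fintype V] (s t : ℝ) :
    dist (edgePoint u v s) (edgePoint u v t) ≤ |s - t| := by
  classical
  refine (dist_pi_le_iff (abs_nonneg _)).2 fun w => ?_
  have : edgePoint u v s w - edgePoint u v t w = (s - t) * (vertexPoint v w - vertexPoint u w) := by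
    simp only [edgePoint, Pi.add_apply, Pi.smul_apply, smul_eq_mul]
    ring
  rw [Real.dist_eq, this, abs_mul]
  refine mul_le_of_le_one_right (abs_nonneg _) ?_
  simp only [vertexPoint, Pi.single_apply]
  split_ifs <;> norm_num

lemma abs_sub_le_dist_edgePoint {u v : V} (h : u ≠ v) [Fintype V] (s t : ℝ) :
    |s - t| ≤ dist (edgePoint u v s) (edgePoint u v t) := by
  have := dist_le_pi_dist (edgePoint u v s) (edgePoint u v t) v
  simpa [edgePoint, vertexPoint_self, vertexPoint_of_ne h.symm, Real.dist_eq] using this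

lemma SimpleGraph.abs_dist_sub_dist_le {G : SimpleGraph V} (hG : G.Connected) {u v : V} (h : u = v ∨ G.Adj u v)
    (w : V) : |(G.dist w u : ℝ) - G.dist w v| ≤ 1 := by
  rcases h with rfl | h
  · simp
  · have h1 := hG.dist_triangle (u := w) (v := v) (w := u)
    have h2 := hG.dist_triangle (u := w) (v := u) (w := v)
    rw [SimpleGraph.dist_eq_one_iff_adj.2 h] at h2
    rw [SimpleGraph.dist_eq_one_iff_adj.2 h.symm] at h1
    rw [abs_le]
    constructor <;> linarith [(Nat.cast_le (α := ℝ)).2 h1, (Nat.cast_le (α := ℝ)).2 h2,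
      Nat.cast_add (R := ℝ) (G.dist w v) 1, Nat.cast_add (R := ℝ) (G.dist w u) 1,
      Nat.cast_one (R := ℝ)]

variable [Fintype V]

/-- The affine extension to the geometric realization of a function on the vertices. -/
def affineExtension (F : V → ℝ) (x : V → ℝ) : ℝ := ∑ w, x w * F w

lemma affineExtension_edgePoint (F : V → ℝ) (u v : V) (t : ℝ) :
    affineExtension F (edgePoint u v t) = (1 - t) * F u + t * F v := by
  classical
  have : ∀ u : V, ∑ w, vertexPoint u w * F w = F u := fun u => by
    simp [vertexPoint, Pi.single_apply]
  simp only [affineExtension, edgePoint, Pi.add_apply, Pi.smul_apply, smul_eq_mul, add_mul,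
    Finset.sum_add_distrib, mul_assoc, ← Finset.mul_sum, this]

variable {G : SimpleGraph V}

lemma abs_affineExtension_sub_le (F : V → ℝ) (hF : ∀ u v, G.Adj u v → |F u - F v| ≤ 1)
    {s : Finset (V → ℝ)} (hs : s ∈ (graphComplex G).cells) {x y : V → ℝ}
    (hx : x ∈ convexHull ℝ (s : Set (V → ℝ))) (hy : y ∈ convexHull ℝ (s : Set (V → ℝ))) :
    |affineExtension F x - affineExtension F y| ≤ dist x y := by
  obtain ⟨u, v, huv, hs⟩ := hs
  obtain ⟨a, -, rfl⟩ := (mem_convexHull_cell hs).1 hx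
  obtain ⟨b, -, rfl⟩ := (mem_convexHull_cell hs).1 hy
  rw [affineExtension_edgePoint, affineExtension_edgePoint]
  have e : (1 - a) * F u + a * F v - ((1 - b) * F u + b * F v) = (b - a) * (F u - F v) := by ring
  rw [e, abs_mul]
  rcases huv with rfl | huv
  · simp [dist_nonneg]
  · refine (mul_le_of_le_one_right (abs_nonneg _) (hF _ _ huv)).trans ?_
    rw [abs_sub_comm]
    exact abs_sub_le_dist_edgePoint huv.ne _ _

variable (G) in
/-- The mean distance of the vertices of two points of the geometric realization. -/
def meanDist (x y : V → ℝ) : ℝ :=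
  affineExtension (fun u => affineExtension (fun w => (G.dist u w : ℝ)) y) x

/-- Continuity is the reason for using `meanDist`: a compactness argument can be applied to it
directly, and it agrees with the path metric up to bounded errors in the directions needed. -/
lemma continuous_meanDist : Continuous fun p : (V → ℝ) × (V → ℝ) => meanDist G p.1 p.2 := by
  unfold meanDist affineExtension
  fun_prop

lemma meanDist_le {x y : V → ℝ} {r : ℝ} (hx : x ∈ (graphComplex G).space)
    (h : ∀ u, |affineExtension (fun w => (G.dist u w : ℝ)) x -
      affineExtension (fun w => (G.dist u w : ℝ)) y| ≤ r) : meanDist G x y ≤ r + 1 := by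
  obtain ⟨s, ⟨u, v, huv, hs⟩, hx⟩ := hx
  obtain ⟨t, ⟨ht0, ht1⟩, rfl⟩ := (mem_convexHull_cell hs).1 hx
  have hd : (G.dist u v : ℝ) ≤ 1 := by
    rcases huv with rfl | huv
    · simp
    · simp [SimpleGraph.dist_eq_one_iff_adj.2 huv]
  -- At `x` the extended distance from either endpoint of its own edge is at most `1`, so at `y` it
  -- is at most `r + 1`.
  have key : ∀ w, (w = u ∨ w = v) →
      affineExtension (fun z => (G.dist w z : ℝ)) y ≤ r + 1 := by
    intro w hw
    have h1 := (abs_le.1 (h w)).1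
    rw [affineExtension_edgePoint] at h1
    have : (1 - t) * (G.dist w u : ℝ) + t * G.dist w v ≤ 1 := by
      rcases hw with rfl | rfl
      · simp only [SimpleGraph.dist_self, Nat.cast_zero]
        nlinarith [Nat.cast_nonneg (α := ℝ) (G.dist w v)]
      · simp only [SimpleGraph.dist_self, Nat.cast_zero, SimpleGraph.dist_comm (u := w)]
        nlinarith [Nat.cast_nonneg (α := ℝ) (G.dist u w)]
    linarith
  rw [meanDist, affineExtension_edgePoint]
  nlinarith [key u (Or.inl rfl), key v (Or.inr rfl)]

/-- One unit is lost in replacing the mean over `u`, `v` by `u`, and another in replacing the mean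
over the endpoints of the edge of `y` by `w`. -/
lemma dist_le_of_meanDist_lt (hG : G.Connected) {u v w : V} (huv : u = v ∨ G.Adj u v) {t r : ℝ}
    (ht : t ∈ Set.Icc (0 : ℝ) 1) {y : V → ℝ} (hy : y ∈ (graphComplex G).space)
    (h : meanDist G (edgePoint u v t) y < r) (hw : y w ≠ 0) : (G.dist u w : ℝ) ≤ r + 2 := by
  obtain ⟨s, ⟨a, b, hab, hs⟩, hy⟩ := hy
  obtain ⟨t', ⟨ht0', ht1'⟩, rfl⟩ := (mem_convexHull_cell hs).1 hy
  have hw' : w = a ∨ w = b := by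
    by_contra! h'
    exact hw (edgePoint_apply_eq_zero _ h'.1 h'.2)
  rw [meanDist, affineExtension_edgePoint, affineExtension_edgePoint,
    affineExtension_edgePoint] at h
  obtain ⟨ht0, ht1⟩ := ht
  have h1 := abs_le.1 (SimpleGraph.abs_dist_sub_dist_le hG huv a)
  have h2 := abs_le.1 (SimpleGraph.abs_dist_sub_dist_le hG huv b)
  have h3 := abs_le.1 (SimpleGraph.abs_dist_sub_dist_le hG hab u)
  simp only [SimpleGraph.dist_comm (u := a), SimpleGraph.dist_comm (u := b)] at h1 h2
  have h4 : (1 - t') * (G.dist u a : ℝ) + t' * G.dist u b ≤ r + 1 := by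
    have : (1 - t') * (G.dist u a : ℝ) + t' * G.dist u b ≤
        (1 - t') * (G.dist v a : ℝ) + t' * G.dist v b + 1 := by nlinarith
    nlinarith
  rcases hw' with rfl | rfl <;> nlinarith

end Graph

/-! ### Rounding a map to a one-dimensional complex -/

/-- If nonnegative numbers that are close to each other have different integer parts, then they are
all close to one positive integer. -/
lemma exists_near_integer {ι : Type*} {s : Set ι} {a : ι → ℝ} (h0 : ∀ x ∈ s, 0 ≤ a x)
    (hs : ∀ x ∈ s, ∀ y ∈ s, |a x - a y| < 1 / 4) {x y : ι} (hx : x ∈ s) (hy : y ∈ s)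
    (hxy : ⌊a x⌋ ≠ ⌊a y⌋) : ∃ k : ℤ, 1 ≤ k ∧ ∀ z ∈ s, |a z - k| < 1 / 4 := by
  wlog h : ⌊a x⌋ < ⌊a y⌋ generalizing x y
  · exact this hy hx hxy.symm (lt_of_le_of_ne (not_lt.1 h) hxy.symm)
  refine ⟨⌊a y⌋, ?_, fun z hz => ?_⟩
  · have := Int.floor_nonneg.2 (h0 x hx)
    omega
  · have h1 : a x < ⌊a y⌋ := Int.floor_lt.1 h
    have h2 := Int.floor_le (a y)
    have h3 := abs_lt.1 (hs z hz x hx)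
    have h4 := abs_lt.1 (hs z hz y hy)
    rw [abs_lt]
    constructor <;> linarith

/-- The points of a small subset of a one-dimensional simplicial complex have at most two different
roundings. -/
lemma floor_eq_or_floor_eq {m : ℕ} {L : PreAbstractSimplicialComplex (Fin m)}
    (hL : ∀ s ∈ L.faces, s.card ≤ 2) (K : ℕ) {s : Set (Fin m → ℝ)}
    (hsL : s ⊆ simplicialRealization L)
    (hs : ∀ x ∈ s, ∀ y ∈ s, ∀ i, |(K + 1 / 2 : ℝ) * x i - (K + 1 / 2 : ℝ) * y i| < 1 / 4)
    {x y : Fin m → ℝ} (hx : x ∈ s) (hy : y ∈ s)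
    (hxy : (fun i => ⌊(K + 1 / 2 : ℝ) * x i⌋) ≠ fun i => ⌊(K + 1 / 2 : ℝ) * y i⌋)
    {z : Fin m → ℝ} (hz : z ∈ s) :
    (fun i => ⌊(K + 1 / 2 : ℝ) * z i⌋) = (fun i => ⌊(K + 1 / 2 : ℝ) * x i⌋) ∨
      (fun i => ⌊(K + 1 / 2 : ℝ) * z i⌋) = fun i => ⌊(K + 1 / 2 : ℝ) * y i⌋ := by
  classical
  set M : ℝ := K + 1 / 2 with hM
  have hM0 : 0 < M := by positivity
  have hnn : ∀ i, ∀ x ∈ s, 0 ≤ M * x i := fun i x hx => mul_nonneg hM0.le ((hsL hx).1.1 i)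
  obtain ⟨i, hi⟩ := Function.ne_iff.1 hxy
  -- Only one coordinate can change its rounding. If two did, both would be near positive integers
  -- `k`, `l` after scaling, so they would span the edge carrying `x` and add up to `K + 1 / 2`.
  -- That half-integer cannot lie within less than `1 / 2` of `k + l`.
  have huniq : ∀ j, j ≠ i → ∀ x' ∈ s, ∀ y' ∈ s, ⌊M * x' j⌋ = ⌊M * y' j⌋ := by
    intro j hj x' hx' y' hy'
    by_contra hne
    obtain ⟨k, hk1, hk⟩ := exists_near_integer (hnn i) (fun a ha b hb => hs a ha b hb i) hx hy hi
    obtain ⟨l, hl1, hl⟩ :=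
      exists_near_integer (hnn j) (fun a ha b hb => hs a ha b hb j) hx' hy' hne
    have hki := abs_lt.1 (hk x hx)
    have hlj := abs_lt.1 (hl x hx)
    have hk1' : (1 : ℝ) ≤ k := by exact_mod_cast hk1
    have hl1' : (1 : ℝ) ≤ l := by exact_mod_cast hl1
    obtain ⟨⟨hx0, hx1⟩, t, ht, hxt⟩ := hsL hx
    have hit : i ∈ t := by
      by_contra h
      rw [hxt i h, mul_zero] at hki
      linarith
    have hjt : j ∈ t := by
      by_contra h
      rw [hxt j h, mul_zero] at hlj
      linarith
    have htij : ({i, j} : Finset (Fin m)) = t := by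
      refine Finset.eq_of_subset_of_card_le ?_ ?_
      · intro a ha
        simp only [Finset.mem_insert, Finset.mem_singleton] at ha
        rcases ha with rfl | rfl <;> assumption
      · rw [Finset.card_pair hj.symm]
        exact hL t ht
    have hsum : x i + x j = 1 := by
      rw [← hx1, ← Finset.sum_pair hj.symm, htij]
      exact Finset.sum_subset (Finset.subset_univ _) fun a _ ha => hxt a ha
    have hMsum : M * x i + M * x j = K + 1 / 2 := by rw [← mul_add, hsum, mul_one]
    have h1 : ((k + l : ℤ) : ℝ) < ((K + 1 : ℤ) : ℝ) := by push_cast; linarith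
    have h2 : ((K : ℤ) : ℝ) < ((k + l : ℤ) : ℝ) := by push_cast; linarith
    rw [Int.cast_lt] at h1 h2
    omega
  have hstep : ∀ x' ∈ s, ∀ y' ∈ s, ⌊M * x' i⌋ ≤ ⌊M * y' i⌋ + 1 := by
    intro x' hx' y' hy'
    have h1 := abs_lt.1 (hs x' hx' y' hy' i)
    rw [← Int.floor_add_one]
    exact Int.floor_le_floor (by linarith)
  -- The roundings of `x` and `y` are consecutive integers, and that of `z` is within one of both.
  have hval : ⌊M * z i⌋ = ⌊M * x i⌋ ∨ ⌊M * z i⌋ = ⌊M * y i⌋ := by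
    have := hstep x hx y hy
    have := hstep y hy x hx
    have := hstep x hx z hz
    have := hstep z hz x hx
    have := hstep y hy z hz
    have := hstep z hz y hy
    simp only [ne_eq] at hi
    omega
  refine hval.imp (fun h => ?_) (fun h => ?_) <;> funext j <;> by_cases hj : j = i
  · rw [hj, h]
  · exact huniq j hj _ hz _ hx
  · rw [hj, h]
  · exact huniq j hj _ hz _ hy

/-- A continuous map with small fibres from a compact space to a one-dimensional complex yields a
self-map that moves points little and takes at most two values on sufficiently small sets. -/
lemma exists_two_valued_map {X : Type*} [PseudoMetricSpace X] [CompactSpace X] {m : ℕ}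
    {L : PreAbstractSimplicialComplex (Fin m)} (hL : ∀ s ∈ L.faces, s.card ≤ 2)
    {f : X → simplicialRealization L} (hf : Continuous f) {σ : X → X → ℝ}
    (hσ : Continuous fun p : X × X => σ p.1 p.2) {r : ℝ} (h : ∀ x y, f x = f y → σ x y < r) :
    ∃ η > 0, ∃ g : X → X, (∀ x, σ x (g x) < r) ∧
      ∀ s : Set X, s.Nonempty → (∀ x ∈ s, ∀ y ∈ s, dist x y < η) →
        ∃ A B, ∀ x ∈ s, g x = A ∨ g x = B := by
  obtain ⟨δ, hδ, hclose⟩ : ∃ δ > 0, ∀ x y, dist (f x) (f y) < δ → σ x y < r := by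
    have hc : IsCompact {p : X × X | r ≤ σ p.1 p.2} :=
      (isClosed_le continuous_const hσ).isCompact
    have hd : Continuous fun p : X × X => dist (f p.1) (f p.2) := by fun_prop
    obtain ⟨δ, hδ, hmin⟩ := hc.exists_forall_le' (a := (0 : ℝ)) hd.continuousOn (fun p hp => by
      refine dist_pos.2 fun he => ?_
      exact absurd (h _ _ he) (not_lt.2 hp))
    refine ⟨δ, hδ, fun x y hxy => ?_⟩
    by_contra hr
    exact absurd (hmin (x, y) (not_lt.1 hr)) (not_le.2 hxy)
  -- Points with equal labels have coordinates differing by less than `1 / M < δ`. The offset `1 /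
  -- 2` in `M` is what `floor_eq_or_floor_eq` needs.
  obtain ⟨K, hK⟩ := exists_nat_gt (1 / δ)
  set M : ℝ := K + 1 / 2 with hM
  have hM0 : 0 < M := by positivity
  have hMδ : 1 < M * δ := by
    rw [div_lt_iff₀ hδ] at hK
    nlinarith
  let label : X → Fin m → ℤ := fun x i => ⌊M * (f x : Fin m → ℝ) i⌋
  -- One representative is chosen for each label that occurs, so `g` depends on the label alone.
  let g : X → X := fun x => Set.rangeSplitting label ⟨label x, x, rfl⟩
  have hg : ∀ x, label (g x) = label x := fun x => Set.apply_rangeSplitting label _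
  have hg' : ∀ x y, label x = label y → g x = g y := fun x y hxy => by simp only [g, hxy]
  have huc := CompactSpace.uniformContinuous_of_continuous hf
  obtain ⟨η, hη, hfη⟩ := Metric.uniformContinuous_iff.1 huc (1 / (4 * M)) (by positivity)
  refine ⟨η, hη, g, fun x => hclose _ _ ?_, fun s hne hs => ?_⟩
  · rw [Subtype.dist_eq, dist_pi_lt_iff hδ]
    intro i
    have := Int.abs_sub_lt_one_of_floor_eq_floor (congrFun (hg x).symm i)
    rw [← mul_sub, abs_mul, abs_of_pos hM0] at this
    rw [Real.dist_eq]
    exact lt_of_mul_lt_mul_left (this.trans hMδ) hM0.le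
  · obtain ⟨x, hx⟩ := hne
    by_cases hall : ∀ y ∈ s, label y = label x
    · exact ⟨g x, g x, fun y hy => Or.inl (hg' _ _ (hall y hy))⟩
    · push Not at hall
      obtain ⟨y, hy, hxy⟩ := hall
      refine ⟨g x, g y, fun z hz => ?_⟩
      refine (floor_eq_or_floor_eq hL K (s := (fun x => (f x : Fin m → ℝ)) '' s) ?_ ?_
        ⟨x, hx, rfl⟩ ⟨y, hy, rfl⟩ hxy.symm ⟨z, hz, rfl⟩).imp (hg' _ _) (hg' _ _)
      · rintro _ ⟨a, -, rfl⟩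
        exact (f a).2
      · rintro _ ⟨a, ha, rfl⟩ _ ⟨b, hb, rfl⟩ i
        have h1 := hfη (hs a ha b hb)
        rw [Subtype.dist_eq] at h1
        have h2 := (dist_le_pi_dist (f a : Fin m → ℝ) (f b) i).trans_lt h1
        rw [Real.dist_eq, lt_div_iff₀ (by positivity)] at h2
        rw [← mul_sub, abs_mul, abs_of_pos hM0]
        linarith

/-! ### Cancellation of sides over a product cycle -/

/-- Summed over a product cycle of subdivided squares, a function of the directed sides of the small
squares that changes sign with the direction vanishes. -/
lemma sum_cycle_boundary_eq_zero {E V Y : Type*} [Fintype E] (src tgt : E → V) {c : E → E → ℝ}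
    (hc₁ : ∀ b, ∀ g : V → ℝ, ∑ a, c a b * (g (tgt a) - g (src a)) = 0)
    (hc₂ : ∀ a, ∀ g : V → ℝ, ∑ b, c a b * (g (tgt b) - g (src b)) = 0)
    (N : ℕ) (pos : E → ℕ → Y) (vert : V → Y) (h0 : ∀ a, pos a 0 = vert (src a))
    (hN : ∀ a, pos a N = vert (tgt a)) (τ : Y × Y → Y × Y → ℝ) (hτ : ∀ x y, τ y x = -τ x y) :
    ∑ a, ∑ b, c a b * ∑ i ∈ Finset.range N, ∑ j ∈ Finset.range N,
      (τ (pos a i, pos b j) (pos a (i + 1), pos b j) +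
        τ (pos a (i + 1), pos b j) (pos a (i + 1), pos b (j + 1)) +
        τ (pos a (i + 1), pos b (j + 1)) (pos a i, pos b (j + 1)) +
        τ (pos a i, pos b (j + 1)) (pos a i, pos b j)) = 0 := by
  -- `h a v` and `k b v` sum `τ` along the two kinds of sides of large squares. Interior sides
  -- telescope away, and the cycle condition in one variable kills each kind.
  set h : E → V → ℝ := fun a v =>
    ∑ i ∈ Finset.range N, τ (pos a i, vert v) (pos a (i + 1), vert v) with hh
  set k : E → V → ℝ := fun b v =>
    ∑ j ∈ Finset.range N, τ (vert v, pos b j) (vert v, pos b (j + 1)) with hk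
  have key : ∀ a b, (∑ i ∈ Finset.range N, ∑ j ∈ Finset.range N,
      (τ (pos a i, pos b j) (pos a (i + 1), pos b j) +
        τ (pos a (i + 1), pos b j) (pos a (i + 1), pos b (j + 1)) +
        τ (pos a (i + 1), pos b (j + 1)) (pos a i, pos b (j + 1)) +
        τ (pos a i, pos b (j + 1)) (pos a i, pos b j))) =
      (k b (tgt a) - k b (src a)) - (h a (tgt b) - h a (src b)) := by
    intro a b
    have e1 : ∑ i ∈ Finset.range N, ∑ j ∈ Finset.range N,
        (τ (pos a i, pos b (j + 1)) (pos a (i + 1), pos b (j + 1)) -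
          τ (pos a i, pos b j) (pos a (i + 1), pos b j)) = h a (tgt b) - h a (src b) := by
      rw [hh]
      simp only
      rw [← Finset.sum_sub_distrib]
      refine Finset.sum_congr rfl fun i _ => ?_
      rw [Finset.sum_range_sub (fun j => τ (pos a i, pos b j) (pos a (i + 1), pos b j)), h0, hN]
    have e2 : ∑ i ∈ Finset.range N, ∑ j ∈ Finset.range N,
        (τ (pos a (i + 1), pos b j) (pos a (i + 1), pos b (j + 1)) -
          τ (pos a i, pos b j) (pos a i, pos b (j + 1))) = k b (tgt a) - k b (src a) := by
      rw [hk, Finset.sum_comm]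
      simp only
      rw [← Finset.sum_sub_distrib]
      refine Finset.sum_congr rfl fun j _ => ?_
      rw [Finset.sum_range_sub (fun i => τ (pos a i, pos b j) (pos a i, pos b (j + 1))), h0, hN]
    rw [← e1, ← e2, ← Finset.sum_sub_distrib]
    refine Finset.sum_congr rfl fun i _ => ?_
    rw [← Finset.sum_sub_distrib]
    refine Finset.sum_congr rfl fun j _ => ?_
    rw [hτ (pos a i, pos b (j + 1)) (pos a (i + 1), pos b (j + 1)),
      hτ (pos a i, pos b j) (pos a i, pos b (j + 1))]
    ring
  simp only [key, mul_sub (_ : ℝ) (_ - _ : ℝ) (_ - _ : ℝ), Finset.sum_sub_distrib, hc₂, sub_zero]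
  rw [Finset.sum_comm]
  simp [hc₁]

/-! ### Signed areas and the two-valued map -/

section Area

variable {P : Type*}

/-- Twice the signed area of the quadrilateral `x y z w` in the plane, when differences of the two
coordinates are given by `φ` and `ψ`. -/
def quadArea (φ ψ : P → P → ℝ) (x y z w : P) : ℝ := φ x z * ψ y w - ψ x z * φ y w

lemma quadArea_eq_sum (φ ψ : P → P → ℝ) (g : P → P) (A B : P → ℝ) (Q : Set P)
    (hφ : ∀ x ∈ Q, ∀ y ∈ Q, φ x y = A y - A x) (hψ : ∀ x ∈ Q, ∀ y ∈ Q, ψ x y = B y - B x)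
    {x y z w : P} (hx : x ∈ Q) (hy : y ∈ Q) (hz : z ∈ Q) (hw : w ∈ Q)
    (hx' : g x ∈ Q) (hy' : g y ∈ Q) (hz' : g z ∈ Q) (hw' : g w ∈ Q)
    (h2 : ∃ C D, ∀ p ∈ ({x, y, z, w} : Set P), g p = C ∨ g p = D) :
    quadArea φ ψ x y (g y) (g x) + quadArea φ ψ y z (g z) (g y) + quadArea φ ψ z w (g w) (g z) +
      quadArea φ ψ w x (g x) (g w) = quadArea φ ψ x y z w := by
  -- The image quadrilateral has zero area: with only two values available, either one diagonal
  -- degenerates or both join the same two points and are parallel.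
  have h0 : (A (g z) - A (g x)) * (B (g w) - B (g y)) -
      (B (g z) - B (g x)) * (A (g w) - A (g y)) = 0 := by
    obtain ⟨C, D, h⟩ := h2
    rcases h x (by simp) with e1 | e1 <;> rcases h y (by simp) with e2 | e2 <;>
      rcases h z (by simp) with e3 | e3 <;> rcases h w (by simp) with e4 | e4 <;>
      rw [e1, e2, e3, e4] <;> ring
  simp only [quadArea, hφ _ hx _ hy', hφ _ hy _ hx', hφ _ hy _ hz', hφ _ hz _ hy', hφ _ hz _ hw',
    hφ _ hw _ hz', hφ _ hw _ hx', hφ _ hx _ hw', hφ _ hx _ hz, hφ _ hy _ hw,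
    hψ _ hx _ hy', hψ _ hy _ hx', hψ _ hy _ hz', hψ _ hz _ hy', hψ _ hz _ hw',
    hψ _ hw _ hz', hψ _ hw _ hx', hψ _ hx _ hw', hψ _ hx _ hz, hψ _ hy _ hw]
  linarith

end Area

/-! ### Local potentials on the realization, and distances in the product -/

section Graph

variable {V : Type*} {G : SimpleGraph V}

/-- The origin of an edge, for an arbitrary choice of orientations. -/
def edgeSrc (e : G.edgeSet) : V := (Quot.out e.1).1

/-- The end of an edge, for an arbitrary choice of orientations. -/
def edgeTgt (e : G.edgeSet) : V := (Quot.out e.1).2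

lemma mk_edgeSrc_edgeTgt (e : G.edgeSet) : s(edgeSrc e, edgeTgt e) = e.1 := Quot.out_eq e.1

lemma adj_edgeSrc_edgeTgt (e : G.edgeSet) : G.Adj (edgeSrc e) (edgeTgt e) := by
  rw [← SimpleGraph.mem_edgeSet, mk_edgeSrc_edgeTgt]
  exact e.2

open scoped Classical in
lemma stepSign_edge (e a : G.edgeSet) :
    SimpleGraph.stepSign (edgeSrc e) (edgeTgt e) (edgeSrc a) (edgeTgt a) =
      if a = e then 1 else 0 := by
  split_ifs with h
  · rw [h, SimpleGraph.stepSign_self (adj_edgeSrc_edgeTgt e).ne]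
  · refine SimpleGraph.stepSign_of_ne fun h' => h (Subtype.ext ?_)
    rw [← mk_edgeSrc_edgeTgt a, h', mk_edgeSrc_edgeTgt]

variable [Fintype V]

/-- The bilinear extension of `SimpleGraph.geodesicCrossing` to the geometric realization. -/
def crossingForm (hG : G.Connected) (e : G.edgeSet) (x y : V → ℝ) : ℝ :=
  affineExtension
    (fun u => affineExtension (SimpleGraph.geodesicCrossing hG (edgeSrc e) (edgeTgt e) u) y) x

variable (G) in
/-- The points of the realization whose carriers lie in a ball of the graph. -/
def carrierBall (o : V) (r : ℕ) : Set (V → ℝ) :=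
  {x | ∑ w, x w = 1 ∧ ∀ w, x w ≠ 0 → G.dist o w ≤ r}

/-- Bilinear extension of `SimpleGraph.geodesicCrossing_eq_sub`; coordinates summing to `1` turn the
bilinear expression into a difference of affine ones. -/
lemma crossingForm_eq_sub (hG : G.Connected) (e : G.edgeSet) {o : V} {r : ℕ}
    (hg : ((4 * r : ℕ) : ℕ∞) < G.egirth) {x y : V → ℝ} (hx : x ∈ carrierBall G o r)
    (hy : y ∈ carrierBall G o r) :
    crossingForm hG e x y =
      affineExtension (SimpleGraph.geodesicCrossing hG (edgeSrc e) (edgeTgt e) o) y -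
      affineExtension (SimpleGraph.geodesicCrossing hG (edgeSrc e) (edgeTgt e) o) x := by
  set Φ := SimpleGraph.geodesicCrossing hG (edgeSrc e) (edgeTgt e)
  have h : ∀ u w, x u * (y w * Φ u w) = x u * (y w * Φ o w) - (x u * Φ o u) * y w := by
    intro u w
    by_cases hu : x u = 0
    · simp [hu]
    by_cases hw : y w = 0
    · simp [hw]
    have := SimpleGraph.geodesicCrossing_eq_sub hG (edgeSrc e) (edgeTgt e) hg (hx.2 u hu) (hy.2 w hw)
    rw [show Φ u w = Φ o w - Φ o u from this]
    ring
  change ∑ u, x u * ∑ w, y w * Φ u w = ∑ w, y w * Φ o w - ∑ w, x w * Φ o w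
  simp only [Finset.mul_sum, h, Finset.sum_sub_distrib]
  simp only [← Finset.mul_sum, ← Finset.sum_mul, hx.1, hy.1, one_mul, mul_one]

lemma sum_eq_one_of_mem_space {x : V → ℝ} (hx : x ∈ (graphComplex G).space) : ∑ w, x w = 1 := by
  obtain ⟨s, ⟨u, v, -, hs⟩, hx⟩ := hx
  obtain ⟨t, -, rfl⟩ := (mem_convexHull_cell hs).1 hx
  simpa [affineExtension] using affineExtension_edgePoint (fun _ => 1) u v t

lemma edgePoint_mem_carrierBall {u v : V} (h : G.Adj u v) (t : ℝ) {r : ℕ} (hr : 1 ≤ r) :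
    edgePoint u v t ∈ carrierBall G u r := by
  refine ⟨by simpa [affineExtension] using affineExtension_edgePoint (fun _ => 1) u v t,
    fun w hw => ?_⟩
  by_cases hu : w = u
  · simp [hu]
  by_cases hv : w = v
  · rw [hv, SimpleGraph.dist_eq_one_iff_adj.2 h]
    exact hr
  exact absurd (edgePoint_apply_eq_zero t hu hv) hw

-- In the planar development the edge `e` is a unit interval, and any other edge `a` collapses to a
-- point.
open scoped Classical in
lemma affineExtension_geodesicCrossing (hG : G.Connected) (e a : G.edgeSet)
    (hg : 2 < G.egirth) (t : ℝ) :
    affineExtension (SimpleGraph.geodesicCrossing hG (edgeSrc e) (edgeTgt e) (edgeSrc a))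
      (edgePoint (edgeSrc a) (edgeTgt a) t) = t * if a = e then 1 else 0 := by
  rw [affineExtension_edgePoint, SimpleGraph.geodesicCrossing_of_adj hG _ _ (Or.inl rfl) hg,
    SimpleGraph.geodesicCrossing_of_adj hG _ _ (Or.inr (adj_edgeSrc_edgeTgt a)) hg,
    SimpleGraph.stepSign_refl, stepSign_edge, mul_zero, zero_add]

variable (G) in
/-- The larger one of the mean distances in the two factors. -/
def meanDist₂ (x y : WithLp 2 ((V → ℝ) × (V → ℝ))) : ℝ :=
  max (meanDist G x.fst y.fst) (meanDist G x.snd y.snd)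

lemma continuous_meanDist₂ :
    Continuous fun p : WithLp 2 ((V → ℝ) × (V → ℝ)) × WithLp 2 ((V → ℝ) × (V → ℝ)) =>
      meanDist₂ G p.1 p.2 := by
  have h1 : Continuous fun x : WithLp 2 ((V → ℝ) × (V → ℝ)) => x.fst := WithLp.continuous_fst _ _ _
  have h2 : Continuous fun x : WithLp 2 ((V → ℝ) × (V → ℝ)) => x.snd := WithLp.continuous_snd _ _ _
  refine Continuous.max ?_ ?_
  · exact continuous_meanDist.comp ((h1.comp continuous_fst).prodMk (h1.comp continuous_snd))
  · exact continuous_meanDist.comp ((h2.comp continuous_fst).prodMk (h2.comp continuous_snd))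

lemma mem_space_prod {E F : Type*} [NormedAddCommGroup E] [NormedSpace ℝ E]
    [NormedAddCommGroup F] [NormedSpace ℝ F] {K : PolyhedralComplex E} {L : PolyhedralComplex F}
    {x : WithLp 2 (E × F)} (hx : x ∈ (K.prod L).space) : x.fst ∈ K.space ∧ x.snd ∈ L.space := by
  obtain ⟨c, ⟨s, hs, t, ht, rfl⟩, hx⟩ := hx
  rw [mem_convexHull_productCell] at hx
  exact ⟨⟨s, hs, hx.1⟩, t, ht, hx.2⟩

lemma meanDist₂_le_of_pathEDist_le (hG : G.Connected) {x y : WithLp 2 ((V → ℝ) × (V → ℝ))}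
    (hx : x ∈ ((graphComplex G).prod (graphComplex G)).space) {R : ℝ≥0}
    (h : ((graphComplex G).prod (graphComplex G)).pathEDist x y ≤ R) :
    meanDist₂ G x y ≤ R + 1 := by
  have hx' := mem_space_prod hx
  refine max_le (meanDist_le hx'.1 fun u => ?_) (meanDist_le hx'.2 fun u => ?_)
  · refine PolyhedralComplex.abs_sub_le_of_pathEDist_le _
      (fun p => affineExtension (fun w => (G.dist u w : ℝ)) p.fst) ?_ h
    rintro _ ⟨s, hs, t, ht, rfl⟩ p hp q hq
    rw [mem_convexHull_productCell] at hp hq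
    exact (abs_affineExtension_sub_le _ (fun a b hab =>
      SimpleGraph.abs_dist_sub_dist_le hG (Or.inr hab) u) hs hp.1 hq.1).trans
      (WithLp.dist_fst_le _ _)
  · refine PolyhedralComplex.abs_sub_le_of_pathEDist_le _
      (fun p => affineExtension (fun w => (G.dist u w : ℝ)) p.snd) ?_ h
    rintro _ ⟨s, hs, t, ht, rfl⟩ p hp q hq
    rw [mem_convexHull_productCell] at hp hq
    exact (abs_affineExtension_sub_le _ (fun a b hab =>
      SimpleGraph.abs_dist_sub_dist_le hG (Or.inr hab) u) ht hp.2 hq.2).trans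
      (WithLp.dist_snd_le _ _)

end Graph

/-! ### Counting destroyed squares -/

section Graph

variable {V : Type*} [Fintype V] {G : SimpleGraph V}

lemma ncard_vertices_prod_le :
    ((graphComplex G).prod (graphComplex G)).vertices.ncard ≤ Fintype.card V ^ 2 := by
  classical
  have hsub : ((graphComplex G).prod (graphComplex G)).vertices ⊆
      (fun p : V × V => WithLp.toLp 2 (vertexPoint p.1, vertexPoint p.2)) '' Set.univ := by
    rintro x ⟨s, ⟨u, v, -, hs⟩, t, ⟨u', v', -, ht⟩, h⟩
    have hx : x ∈ productCell s t := by rw [← h]; simp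
    rw [mem_productCell, ← Finset.mem_coe, ← Finset.mem_coe, hs, ht] at hx
    have h1 : ∃ a, vertexPoint a = x.fst := by
      rcases hx.1 with h | h <;> exact ⟨_, h.symm⟩
    have h2 : ∃ a, vertexPoint a = x.snd := by
      rcases hx.2 with h | h <;> exact ⟨_, h.symm⟩
    obtain ⟨a, ha⟩ := h1
    obtain ⟨b, hb⟩ := h2
    exact ⟨(a, b), trivial, (WithLp.ofLp_injective 2) (Prod.ext ha hb)⟩
  refine (Set.ncard_le_ncard hsub (Set.toFinite _)).trans ((Set.ncard_image_le).trans ?_)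
  rw [Set.ncard_univ, Nat.card_eq_fintype_card, Fintype.card_prod, sq]

/-- The `1`-cell of an edge. -/
def edgeCell (e : G.edgeSet) : Finset (V → ℝ) :=
  Finset.map ⟨vertexPoint, vertexPoint_injective⟩ (Set.toFinite {w | w ∈ e.1}).toFinset

lemma mem_edgeCell {e : G.edgeSet} {x : V → ℝ} :
    x ∈ edgeCell e ↔ ∃ w ∈ e.1, vertexPoint w = x := by
  simp [edgeCell]

lemma coe_edgeCell (e : G.edgeSet) : (edgeCell e : Set (V → ℝ)) =
    {vertexPoint (edgeSrc e), vertexPoint (edgeTgt e)} := by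
  ext x
  rw [Finset.mem_coe, mem_edgeCell, ← mk_edgeSrc_edgeTgt]
  simp [eq_comm]

lemma edgeCell_mem (e : G.edgeSet) : edgeCell e ∈ (graphComplex G).cells :=
  ⟨_, _, Or.inr (adj_edgeSrc_edgeTgt e), coe_edgeCell e⟩

lemma edgePoint_mem_edgeCell (e : G.edgeSet) {t : ℝ} (ht : t ∈ Set.Icc (0 : ℝ) 1) :
    edgePoint (edgeSrc e) (edgeTgt e) t ∈ convexHull ℝ (edgeCell e : Set (V → ℝ)) :=
  (mem_convexHull_cell (coe_edgeCell e)).2 ⟨t, ht, rfl⟩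

open scoped Classical in
lemma card_filter_mem_edgeCell_le {d : ℕ} (hreg : ∀ v, G.degree v ≤ d) (x : V → ℝ) :
    (Finset.univ.filter fun e : G.edgeSet => x ∈ edgeCell e).card ≤ d := by
  by_cases h : ∃ v, vertexPoint v = x
  · obtain ⟨v, rfl⟩ := h
    refine le_trans ?_ (hreg v)
    rw [← G.card_incidenceFinset_eq_degree v]
    refine Finset.card_le_card_of_injOn Subtype.val ?_ Subtype.val_injective.injOn
    intro e he
    rw [Finset.mem_coe, Finset.mem_filter, mem_edgeCell] at he
    obtain ⟨-, w, hw, hwv⟩ := he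
    rw [Finset.mem_coe, SimpleGraph.mem_incidenceFinset]
    exact ⟨e.2, vertexPoint_injective hwv ▸ hw⟩
  · rw [Finset.filter_false_of_mem, Finset.card_empty]
    · exact Nat.zero_le _
    · intro e _ he
      obtain ⟨w, -, hw⟩ := mem_edgeCell.1 he
      exact h ⟨w, hw⟩

open scoped Classical in
lemma card_filter_not_disjoint_le {d : ℕ} (hreg : ∀ v, G.degree v ≤ d)
    (S : Finset (WithLp 2 ((V → ℝ) × (V → ℝ)))) :
    (Finset.univ.filter fun p : G.edgeSet × G.edgeSet =>
      ¬ Disjoint (productCell (edgeCell p.1) (edgeCell p.2)) S).card ≤ S.card * (d * d) := by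
  have hsub : (Finset.univ.filter fun p : G.edgeSet × G.edgeSet =>
      ¬ Disjoint (productCell (edgeCell p.1) (edgeCell p.2)) S) ⊆
      S.biUnion fun x => (Finset.univ.filter fun e : G.edgeSet => x.fst ∈ edgeCell e) ×ˢ
        (Finset.univ.filter fun e : G.edgeSet => x.snd ∈ edgeCell e) := by
    intro p hp
    rw [Finset.mem_filter, Finset.not_disjoint_iff] at hp
    obtain ⟨-, x, hx, hxS⟩ := hp
    rw [mem_productCell] at hx
    simp only [Finset.mem_biUnion, Finset.mem_product, Finset.mem_filter, Finset.mem_univ, true_and]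
    exact ⟨x, hxS, hx⟩
  refine (Finset.card_le_card hsub).trans (Finset.card_biUnion_le_card_mul _ _ _ fun x _ => ?_)
  rw [Finset.card_product]
  exact Nat.mul_le_mul (card_filter_mem_edgeCell_le hreg _) (card_filter_mem_edgeCell_le hreg _)

open scoped Classical in
/-- If few vertices of the product of a regular graph with itself are removed, then there remains a
nonzero `2`-cycle. -/
lemma exists_cycle_avoiding [Nonempty V] {d : ℕ} (hd : 3 ≤ d) (hreg : G.IsRegularOfDegree d)
    (S : Finset (WithLp 2 ((V → ℝ) × (V → ℝ))))
    (hS : (S.card : ℝ) ≤ 1 / (8 * d ^ 2) *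
      ((graphComplex G).prod (graphComplex G)).vertices.ncard) :
    ∃ c : G.edgeSet → G.edgeSet → ℝ, (∃ a b, c a b ≠ 0) ∧
      (∀ a b, c a b ≠ 0 → Disjoint (productCell (edgeCell a) (edgeCell b)) S) ∧
      (∀ b, ∀ g : V → ℝ, ∑ a, c a b * (g (edgeTgt a) - g (edgeSrc a)) = 0) ∧
      ∀ a, ∀ g : V → ℝ, ∑ b, c a b * (g (edgeTgt b) - g (edgeSrc b)) = 0 := by
  have hE : 2 * Fintype.card G.edgeSet = Fintype.card V * d := by
    have h1 := G.sum_degrees_eq_twice_card_edges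
    rw [Finset.sum_congr rfl fun v _ => hreg.degree_eq v, Finset.sum_const, smul_eq_mul,
      Finset.card_univ, SimpleGraph.edgeFinset, Set.toFinset_card] at h1
    omega
  have hN : 0 < Fintype.card V := Fintype.card_pos
  have hVE : 3 * Fintype.card V ≤ 2 * Fintype.card G.edgeSet := by
    rw [hE, mul_comm]
    exact Nat.mul_le_mul_left _ hd
  obtain ⟨k, hk⟩ : ∃ k, k + Fintype.card V = Fintype.card G.edgeSet :=
    ⟨Fintype.card G.edgeSet - Fintype.card V, by omega⟩
  have hbad := card_filter_not_disjoint_le (G := G) (d := d) (fun v => (hreg.degree_eq v).le) S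
  -- At most `|V|² / 8` squares are lost, while `k ≥ |V| / 2` gives `k² ≥ |V|² / 4`.
  have hlt : S.card * (d * d) < k ^ 2 := by
    have hd0 : (0 : ℝ) < d := by exact_mod_cast (by omega : 0 < d)
    have h1 : (((graphComplex G).prod (graphComplex G)).vertices.ncard : ℝ) ≤
        (Fintype.card V : ℝ) ^ 2 := by exact_mod_cast ncard_vertices_prod_le
    have h2 : (Fintype.card V : ℝ) ≤ 2 * k := by
      exact_mod_cast (by omega : Fintype.card V ≤ 2 * k)
    have h3 : (0 : ℝ) < Fintype.card V := by exact_mod_cast hN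
    have h4 : (S.card : ℝ) * (d * d) ≤ (Fintype.card V : ℝ) ^ 2 / 8 := by
      have := mul_le_mul_of_nonneg_right (hS.trans (mul_le_mul_of_nonneg_left h1 (by positivity)))
        (by positivity : (0 : ℝ) ≤ d * d)
      refine this.trans (le_of_eq ?_)
      field_simp
    have h5 : (S.card : ℝ) * (d * d) < (k : ℝ) ^ 2 := by nlinarith
    exact_mod_cast h5
  obtain ⟨c, h0, hc, h1, h2⟩ := exists_product_cycle edgeSrc edgeTgt hk.le _ (hbad.trans_lt hlt)
  refine ⟨c, h0, fun a b hab => ?_, h1, h2⟩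
  by_contra h
  exact hab (hc a b (Finset.mem_filter.2 ⟨Finset.mem_univ _, h⟩))

/-! ### The area contradiction -/

open scoped Classical in
/-- After the removal of few vertices from the product of a regular graph of large girth with
itself, the remaining complex has no map to a graph with small fibres. -/
theorem not_isLocalizable_of_girth (hG : G.Connected) {d : ℕ} (hd : 3 ≤ d) (hreg : G.IsRegularOfDegree d)
    {R : ℝ≥0} {r : ℕ} (hr : (R : ℝ) + 4 ≤ r)
    (hg : ((4 * r : ℕ) : ℕ∞) < G.egirth) (S : Finset (WithLp 2 ((V → ℝ) × (V → ℝ))))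
    (hS : (S.card : ℝ) ≤ 1 / (8 * d ^ 2) *
      ((graphComplex G).prod (graphComplex G)).vertices.ncard)
    (δ : WithLp 2 ((V → ℝ) × (V → ℝ)) → WithLp 2 ((V → ℝ) × (V → ℝ)) → ℝ≥0∞)
    (hδ : ∀ x y, ((graphComplex G).prod (graphComplex G)).pathEDist x y ≤ δ x y) :
    ¬ IsLocalizable 1 R (((graphComplex G).prod (graphComplex G)).deleteVertices S) δ := by
  set K := ((graphComplex G).prod (graphComplex G)).deleteVertices S with hK
  rintro ⟨m, L, hL, f, hf, hfib⟩
  have hKsub : K.space ⊆ ((graphComplex G).prod (graphComplex G)).space :=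
    fun x ⟨s, hs, hx⟩ => ⟨s, hs.1, hx⟩
  have : CompactSpace K.space := isCompact_iff_compactSpace.1 K.isCompact_space
  have : Nonempty V := hG.nonempty
  have hr1 : 1 ≤ r := by
    have : (1 : ℝ) ≤ r := by linarith [R.coe_nonneg]
    exact_mod_cast this
  have hg2 : 2 < G.egirth := lt_of_le_of_lt (by exact_mod_cast (by omega : 2 ≤ 4 * r)) hg
  -- Fibres of `d`-diameter below `R` have `meanDist₂` at most `R + 1`. The strict bound `R + 2`
  -- then becomes a carrier distance of at most `R + 4 ≤ r`.
  obtain ⟨η, hη, g, hgclose, hg2val⟩ := exists_two_valued_map hL hf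
    (σ := fun x y => meanDist₂ G x y) (r := (R : ℝ) + 2)
    (continuous_meanDist₂.comp ((continuous_subtype_val.comp continuous_fst).prodMk
      (continuous_subtype_val.comp continuous_snd))) (by
      intro x y hxy
      have h1 : δ x y < R := lt_of_le_of_lt
        (le_iSup_of_le x (le_iSup_of_le y (by simp [hxy])))
        (hfib (f x))
      have := meanDist₂_le_of_pathEDist_le hG (hKsub x.2) ((hδ x y).trans h1.le)
      linarith)
  obtain ⟨c, ⟨e, e', hee'⟩, hcS, hc₁, hc₂⟩ := exists_cycle_avoiding hd hreg S hS
  obtain ⟨N, hN⟩ := exists_nat_gt (2 / η)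
  have hN0 : (0 : ℝ) < N := lt_of_le_of_lt (by positivity) hN
  have hNη : 2 / (N : ℝ) < η := by
    rw [div_lt_iff₀ hη] at hN
    rw [div_lt_iff₀ hN0]
    linarith
  let pos : G.edgeSet → ℕ → V → ℝ := fun a i => edgePoint (edgeSrc a) (edgeTgt a) (i / N)
  -- The value outside the remaining complex is irrelevant, since the squares with `c a b ≠ 0` lie
  -- inside it.
  let g' : (V → ℝ) × (V → ℝ) → (V → ℝ) × (V → ℝ) := fun p =>
    if h : WithLp.toLp 2 p ∈ K.space then WithLp.ofLp (g ⟨_, h⟩ : WithLp 2 ((V → ℝ) × (V → ℝ)))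
    else p
  let φ : (V → ℝ) × (V → ℝ) → (V → ℝ) × (V → ℝ) → ℝ := fun p q => crossingForm hG e p.1 q.1
  let ψ : (V → ℝ) × (V → ℝ) → (V → ℝ) × (V → ℝ) → ℝ := fun p q => crossingForm hG e' p.2 q.2
  -- The function of a directed side is the area swept between the side and its image under `g'`.
  have hzero := sum_cycle_boundary_eq_zero edgeSrc edgeTgt hc₁ hc₂ N pos vertexPoint
    (fun a => by simp [pos, edgePoint]) (fun a => by simp [pos, edgePoint, hN0.ne'])
    (fun x y => quadArea φ ψ x y (g' y) (g' x)) (fun x y => by simp only [quadArea]; ring)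
  have hsquare : ∀ a b, c a b ≠ 0 → ∀ i < N, ∀ j < N,
      quadArea φ ψ (pos a i, pos b j) (pos a (i + 1), pos b j)
          (g' (pos a (i + 1), pos b j)) (g' (pos a i, pos b j)) +
        quadArea φ ψ (pos a (i + 1), pos b j) (pos a (i + 1), pos b (j + 1))
          (g' (pos a (i + 1), pos b (j + 1))) (g' (pos a (i + 1), pos b j)) +
        quadArea φ ψ (pos a (i + 1), pos b (j + 1)) (pos a i, pos b (j + 1))
          (g' (pos a i, pos b (j + 1))) (g' (pos a (i + 1), pos b (j + 1))) +
        quadArea φ ψ (pos a i, pos b (j + 1)) (pos a i, pos b j)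
          (g' (pos a i, pos b j)) (g' (pos a i, pos b (j + 1))) =
      2 / (N : ℝ) ^ 2 * ((if a = e then 1 else 0) * (if b = e' then 1 else 0)) := by
    intro a b hab i hi j hj
    have hcell : productCell (edgeCell a) (edgeCell b) ∈ K.cells :=
      ⟨⟨_, edgeCell_mem a, _, edgeCell_mem b, rfl⟩, hcS a b hab⟩
    have hI : ∀ i ≤ N, ((i : ℕ) / N : ℝ) ∈ Set.Icc (0 : ℝ) 1 := fun i hi =>
      ⟨by positivity, (div_le_one hN0).2 (by exact_mod_cast hi)⟩
    have hmem : ∀ i ≤ N, ∀ j ≤ N, WithLp.toLp 2 (pos a i, pos b j) ∈ K.space := fun i hi j hj =>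
      ⟨_, hcell, mem_convexHull_productCell.2
        ⟨edgePoint_mem_edgeCell a (hI i hi), edgePoint_mem_edgeCell b (hI j hj)⟩⟩
    have hg' : ∀ i, (hi : i ≤ N) → ∀ j, (hj : j ≤ N) →
        g' (pos a i, pos b j) = WithLp.ofLp (g ⟨_, hmem i hi j hj⟩ : WithLp 2 _) :=
      fun i hi j hj => dif_pos (hmem i hi j hj)
    -- A region containing the small square and its image on which both crossing forms have
    -- potentials.
    set Q : Set ((V → ℝ) × (V → ℝ)) :=
      carrierBall G (edgeSrc a) r ×ˢ carrierBall G (edgeSrc b) r with hQ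
    have hposQ : ∀ i j, (pos a i, pos b j) ∈ Q := fun i j =>
      ⟨edgePoint_mem_carrierBall (adj_edgeSrc_edgeTgt a) _ hr1,
        edgePoint_mem_carrierBall (adj_edgeSrc_edgeTgt b) _ hr1⟩
    have hgQ : ∀ i ≤ N, ∀ j ≤ N, g' (pos a i, pos b j) ∈ Q := by
      intro i hi j hj
      rw [hg' i hi j hj]
      have h1 := mem_space_prod (hKsub (g ⟨_, hmem i hi j hj⟩).2)
      have h2 := hgclose ⟨_, hmem i hi j hj⟩
      refine ⟨⟨sum_eq_one_of_mem_space h1.1, fun w hw => ?_⟩,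
        sum_eq_one_of_mem_space h1.2, fun w hw => ?_⟩
      · have := dist_le_of_meanDist_lt hG (Or.inr (adj_edgeSrc_edgeTgt a)) (hI i hi) h1.1
          ((le_max_left _ _).trans_lt h2) hw
        exact_mod_cast (by linarith : (G.dist (edgeSrc a) w : ℝ) ≤ r)
      · have := dist_le_of_meanDist_lt hG (Or.inr (adj_edgeSrc_edgeTgt b)) (hI j hj) h1.2
          ((le_max_right _ _).trans_lt h2) hw
        exact_mod_cast (by linarith : (G.dist (edgeSrc b) w : ℝ) ≤ r)
    have hdist : ∀ i j i' j' : ℕ, |(i : ℝ) - i'| ≤ 1 → |(j : ℝ) - j'| ≤ 1 →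
        dist (WithLp.toLp 2 (pos a i, pos b j)) (WithLp.toLp 2 (pos a i', pos b j')) < η := by
      intro i j i' j' h1 h2
      refine lt_of_le_of_lt ?_ hNη
      have e1 : ∀ (a : G.edgeSet) (i i' : ℕ), |(i : ℝ) - i'| ≤ 1 →
          dist (pos a i) (pos a i') ≤ 1 / N := fun a i i' h => by
        refine (dist_edgePoint_le _ _ _ _).trans ?_
        rw [← sub_div, abs_div, abs_of_pos hN0]
        gcongr
      have e2 := e1 a i i' h1
      have e3 := e1 b j j' h2
      rw [WithLp.prod_dist_eq_of_L2, Real.sqrt_le_left (by positivity)]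
      simp only [WithLp.toLp_fst, WithLp.toLp_snd]
      have e4 : (2 / N : ℝ) = 1 / N + 1 / N := by ring
      have e5 := dist_nonneg (x := pos a i) (y := pos a i')
      have e6 := dist_nonneg (x := pos b j) (y := pos b j')
      rw [e4]
      nlinarith
    have htwo : ∃ C D, ∀ p ∈ ({(pos a i, pos b j), (pos a (i + 1), pos b j),
        (pos a (i + 1), pos b (j + 1)), (pos a i, pos b (j + 1))} : Set ((V → ℝ) × (V → ℝ))),
        g' p = C ∨ g' p = D := by
      obtain ⟨C, D, h⟩ := hg2val
        {x | ∃ i' j' : ℕ, (i' = i ∨ i' = i + 1) ∧ (j' = j ∨ j' = j + 1) ∧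
          (x : WithLp 2 ((V → ℝ) × (V → ℝ))) = WithLp.toLp 2 (pos a i', pos b j')}
        ⟨⟨_, hmem i hi.le j hj.le⟩, i, j, Or.inl rfl, Or.inl rfl, rfl⟩ (by
          rintro x ⟨i₁, j₁, hi₁, hj₁, hx⟩ y ⟨i₂, j₂, hi₂, hj₂, hy⟩
          rw [Subtype.dist_eq, hx, hy]
          apply hdist
          · rcases hi₁ with rfl | rfl <;> rcases hi₂ with rfl | rfl <;> simp
          · rcases hj₁ with rfl | rfl <;> rcases hj₂ with rfl | rfl <;> simp)
      have key : ∀ i' j' : ℕ, (i' = i ∨ i' = i + 1) → (j' = j ∨ j' = j + 1) →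
          g' (pos a i', pos b j') = WithLp.ofLp (C : WithLp 2 _) ∨
            g' (pos a i', pos b j') = WithLp.ofLp (D : WithLp 2 _) := by
        intro i' j' hi' hj'
        rw [hg' i' (by omega) j' (by omega)]
        refine (h ⟨_, hmem i' (by omega) j' (by omega)⟩ ⟨i', j', hi', hj', rfl⟩).imp ?_ ?_ <;>
          exact fun h => by rw [h]
      refine ⟨WithLp.ofLp C.1, WithLp.ofLp D.1, ?_⟩
      rintro p (rfl | rfl | rfl | rfl)
      · exact key _ _ (Or.inl rfl) (Or.inl rfl)
      · exact key _ _ (Or.inr rfl) (Or.inl rfl)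
      · exact key _ _ (Or.inr rfl) (Or.inr rfl)
      · exact key _ _ (Or.inl rfl) (Or.inr rfl)
    set A : (V → ℝ) × (V → ℝ) → ℝ := fun p => affineExtension
      (SimpleGraph.geodesicCrossing hG (edgeSrc e) (edgeTgt e) (edgeSrc a)) p.1 with hA
    set B : (V → ℝ) × (V → ℝ) → ℝ := fun p => affineExtension
      (SimpleGraph.geodesicCrossing hG (edgeSrc e') (edgeTgt e') (edgeSrc b)) p.2 with hB
    have hφ : ∀ x ∈ Q, ∀ y ∈ Q, φ x y = A y - A x := fun x hx y hy =>
      crossingForm_eq_sub hG e hg hx.1 hy.1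
    have hψ : ∀ x ∈ Q, ∀ y ∈ Q, ψ x y = B y - B x := fun x hx y hy =>
      crossingForm_eq_sub hG e' hg hx.2 hy.2
    rw [quadArea_eq_sum φ ψ g' A B Q hφ hψ (hposQ _ _) (hposQ _ _) (hposQ _ _) (hposQ _ _)
      (hgQ _ hi.le _ hj.le) (hgQ _ hi _ hj.le) (hgQ _ hi _ hj) (hgQ _ hi.le _ hj) htwo,
      quadArea, hφ _ (hposQ _ _) _ (hposQ _ _), hφ _ (hposQ _ _) _ (hposQ _ _),
      hψ _ (hposQ _ _) _ (hposQ _ _)]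
    have hAv : ∀ i j, A (pos a i, pos b j) = (i / N : ℝ) * if a = e then 1 else 0 := fun i j =>
      affineExtension_geodesicCrossing hG e a hg2 _
    have hBv : ∀ i j, B (pos a i, pos b j) = (j / N : ℝ) * if b = e' then 1 else 0 := fun i j =>
      affineExtension_geodesicCrossing hG e' b hg2 _
    simp only [hAv, hBv]
    push_cast
    field_simp
    ring
  have hsum : ∀ a b, c a b * (2 * ((if a = e then 1 else 0) * (if b = e' then 1 else 0))) = c a b *
      ∑ i ∈ Finset.range N, ∑ j ∈ Finset.range N,
      2 / (N : ℝ) ^ 2 * ((if a = e then 1 else 0) * (if b = e' then 1 else 0)) := by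
    intro a b
    simp only [Finset.sum_const, Finset.card_range, nsmul_eq_mul]
    field_simp
  -- The `N²` small squares of `(e, e')` each contribute twice their area, `2 / N²`; all other
  -- squares contribute nothing.
  have htotal : ∑ a, ∑ b, c a b * (2 * ((if a = e then 1 else 0) * (if b = e' then 1 else 0))) = 0 := by
    refine Eq.trans ?_ hzero
    refine Finset.sum_congr rfl fun a _ => Finset.sum_congr rfl fun b _ => ?_
    rw [hsum]
    by_cases hab : c a b = 0
    · rw [hab, zero_mul, zero_mul]
    · congr 1
      refine Finset.sum_congr rfl fun i hi => Finset.sum_congr rfl fun j hj => ?_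
      exact (hsquare a b hab i (Finset.mem_range.1 hi) j (Finset.mem_range.1 hj)).symm
  simp at htotal
  exact hee' htotal

end Graph

end

theorem mainTheorem2 (d : ℕ) (hd : 3 ≤ d) (V : ℕ → Type*) [∀ n, Fintype (V n)]
    (G : ∀ n, SimpleGraph (V n)) [∀ n, DecidableRel (G n).Adj]
    (hconn : ∀ n, (G n).Connected) (hreg : ∀ n, (G n).IsRegularOfDegree d)
    (hgirth : Filter.Tendsto (fun n => (G n).egirth) Filter.atTop (𝓝 ⊤)) :
    ¬ IsHyperfinite 1 (fun n => (graphComplex (G n)).prod (graphComplex (G n))) ∧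
    ¬ IsAmbientHyperfinite 1 (fun n => (graphComplex (G n)).prod (graphComplex (G n))) := by
  have hd0 : (0 : ℝ) < d := by exact_mod_cast (by omega : 0 < d)
  have hε : (0 : ℝ) < 1 / (8 * d ^ 2) := by positivity
  -- The bound on the removed fraction does not depend on `R`; only the girth has to be large
  -- compared with `R`. Both metrics dominate the ambient path metric, so one statement covers the
  -- two variants.
  have hex : ∀ R : ℝ≥0, ∃ (n r : ℕ), (R : ℝ) + 4 ≤ r ∧ ((4 * r : ℕ) : ℕ∞) < (G n).egirth := by
    intro R
    obtain ⟨r, hr⟩ := exists_nat_ge ((R : ℝ) + 4)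
    obtain ⟨n, hn⟩ := (hgirth.eventually
      (lt_mem_nhds (ENat.natCast_lt_top (4 * r)))).exists
    exact ⟨n, r, hr, hn⟩
  constructor
  · intro h
    obtain ⟨R, hR⟩ := h _ hε
    obtain ⟨n, r, hr, hg⟩ := hex R
    obtain ⟨S, -, hS, hloc⟩ := hR n
    exact not_isLocalizable_of_girth (hconn n) hd (by convert hreg n) hr hg S hS _
      (fun x y => PolyhedralComplex.pathEDist_le_deleteVertices _ S x y) hloc
  · intro h
    obtain ⟨R, hR⟩ := h _ hε
    obtain ⟨n, r, hr, hg⟩ := hex R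
    obtain ⟨S, -, hS, hloc⟩ := hR n
    exact not_isLocalizable_of_girth (hconn n) hd (by convert hreg n) hr hg S hS _ (fun x y => le_rfl) hloc
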